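/- Let $K$ be a number field with ring of integers $R$, let $\mathfrak p$ be a nonzero prime ideal of $R$, let $R_{\mathfrak p}$ be the localisation of $R$ at $\mathfrak p$, and let $k_{\mathfrak p}=R_{\mathfrak p}/\mathfrak pR_{\mathfrak p}$ be its residue field. Let $H$ be an associative unital $R$-algebra that is free of finite rank as an $R$-module, and put $SH:=S\otimes_R H$ for $S\in\{K,R_{\mathfrak p},k_{\mathfrak p}\}$. Assume that $K$ is a splitting field for $KH$ and that $k_{\mathfrak p}$ is a splitting field for $k_{\mathfrak p}H$ (every endomorphism of a simple module is multiplication by a scalar); $KH$ need not be semisimple. For a finite-dimensional algebra $A$ over a field, let $R_0(A)$ be the Grothendieck group of the category of finite-dimensional right $A$-modules and $K_0(A)$ that of the finite-dimensional projective right $A$-modules (both with respect to short exact sequences), and let $\langle -\mid-\rangle : K_0(A)\times R_0(A)\to\mathbb Z$ be the biadditive pairing with $\langle [P]\mid[V]\rangle=\dim\operatorname{Hom}_A(P,V)$. Then: 1. There is a unique homomorphism $d_{\mathfrak p}:R_0(KH)\to R_0(k_{\mathfrak p}H)$ (the decomposition map) such that $d_{\mathfrak p}([V])=[k_{\mathfrak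 p}\otimes_{R_{\mathfrak p}}\tilde V]$ for every simple right $KH$-module $V$ and every right $R_{\mathfrak p}H$-module $\tilde V$ that is free of finite rank over $R_{\mathfrak p}$ and satisfies $K\otimes_{R_{\mathfrak p}}\tilde V\cong V$ as $KH$-modules. 2. There is a unique homomorphism $e_{\mathfrak p}:K_0(k_{\mathfrak p}H)\to K_0(KH)$ such that $e_{\mathfrak p}([f\,k_{\mathfrak p}H])=[e\,KH]$ for every primitive idempotent $f\in k_{\mathfrak p}H$ and every idempotent $e\in R_{\mathfrak p}H$ that is mapped to $f$ under $R_{\mathfrak p}H\to k_{\mathfrak p}H$. 3. (Brauer reciprocity) The map $e_{\mathfrak p}$ is dual to $d_{\mathfrak p}$: $$\langle e_{\mathfrak p}(x)\mid y\rangle=\langle x\mid d_{\mathfrak p}(y)\rangle\qquad\text{for all }x\in K_0(k_{\mathfrak p}H),\ y\in R_0(KH).$$ 4. Let $(S_i)_i$ and $(T_j)_j$ be complete systems of representatives of the isomorphism classes of simple right modules of $KH$ and of $k_{\mathfrak p}H$, and let $P_i$ and $Q_j$ be finite-dimensional projective indecomposable modules with heads $P_i/\operatorname{rad}(P_i)\cong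 S_i$ and $Q_j/\operatorname{rad}(Q_j)\cong T_j$. Then $([S_i])_i$, $([P_i])_i$, $([T_j])_j$, $([Q_j])_j$ are $\mathbb Z$-bases of $R_0(KH)$, $K_0(KH)$, $R_0(k_{\mathfrak p}H)$, $K_0(k_{\mathfrak p}H)$, and with respect to these bases the matrix of $e_{\mathfrak p}$ is the transpose of the matrix of $d_{\mathfrak p}$ (the decomposition matrix); here row $b$ of the matrix of a map holds the coordinates of the image of the basis element $b$. -/

import Mathlib

open scoped TensorProduct NumberField Matrix

universe u v w

/-! ## Right modules and Grothendieck groups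

A right module over a ring `A` is a module over the opposite ring `Aᵐᵒᵖ`. -/

/-- A right module over the `F`-algebra `A` that is finitely generated over `F` (for a field `F`:
a finite-dimensional right `A`-module), the `F`-structure being the one induced by `A`. -/
structure FinRightMod (F : Type*) (A : Type*) [CommRing F] [Ring A] [Algebra F A] where
  carrier : Type w
  [addCommGroup : AddCommGroup carrier]
  [baseModule : Module F carrier]
  [rightModule : Module Aᵐᵒᵖ carrier]
  [isScalarTower : IsScalarTower F Aᵐᵒᵖ carrier]
  [finite : Module.Finite F carrier]

namespace FinRightMod

instance (F A : Type*) [CommRing F] [Ring A] [Algebra F A] :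
    CoeSort (FinRightMod.{w} F A) (Type w) := ⟨FinRightMod.carrier⟩

attribute [instance] addCommGroup baseModule rightModule isScalarTower finite

end FinRightMod

section Grothendieck

variable (F : Type*) (A : Type*) [CommRing F] [Ring A] [Algebra F A]

/-- The relations `[M] - [M'] - [M'']`, one for each short exact sequence `0 → M' → M → M'' → 0`
of right `A`-modules all of whose terms satisfy `C`. -/
def grothendieckRelations (C : FinRightMod.{w} F A → Prop) :
    Set (FreeAbelianGroup {M : FinRightMod.{w} F A // C M}) :=
  {x | ∃ (M' M M'' : {M : FinRightMod.{w} F A // C M})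
      (i : M'.1 →ₗ[Aᵐᵒᵖ] M.1) (q : M.1 →ₗ[Aᵐᵒᵖ] M''.1),
      Function.Injective i ∧ Function.Exact i q ∧ Function.Surjective q ∧
      x = FreeAbelianGroup.of M - FreeAbelianGroup.of M' - FreeAbelianGroup.of M''}

/-- The Grothendieck group of the category of the finite right `A`-modules that satisfy `C`. -/
def GrothendieckGroup (C : FinRightMod.{w} F A → Prop) : Type _ :=
  FreeAbelianGroup {M : FinRightMod.{w} F A // C M} ⧸
    AddSubgroup.closure (grothendieckRelations F A C)

noncomputable instance (C : FinRightMod.{w} F A → Prop) :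
    AddCommGroup (GrothendieckGroup F A C) :=
  inferInstanceAs (AddCommGroup (_ ⧸ AddSubgroup.closure (grothendieckRelations F A C)))

/-- `R₀(A)`: the Grothendieck group of all finite-dimensional right `A`-modules. -/
abbrev R0 : Type _ := GrothendieckGroup.{w} F A fun _ => True

/-- `K₀(A)`: the Grothendieck group of the finite-dimensional projective right `A`-modules. -/
abbrev K0 : Type _ := GrothendieckGroup.{w} F A fun M => Module.Projective Aᵐᵒᵖ M

end Grothendieck

section Classes

variable {F : Type*} {A : Type*} [CommRing F] [Ring A] [Algebra F A]

/-- The class `[M]` of a module in the Grothendieck group. -/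
def GrothendieckGroup.mk {C : FinRightMod.{w} F A → Prop} (M : FinRightMod.{w} F A) (h : C M) :
    GrothendieckGroup F A C :=
  QuotientAddGroup.mk (FreeAbelianGroup.of ⟨M, h⟩)

/-- A function on modules that is additive on short exact sequences induces a homomorphism on the
Grothendieck group. -/
noncomputable def GrothendieckGroup.lift {C : FinRightMod.{w} F A → Prop} {G : Type*}
    [AddCommGroup G] (φ : {M : FinRightMod.{w} F A // C M} → G)
    (hφ : ∀ (M' M M'' : {M : FinRightMod.{w} F A // C M})
      (i : M'.1 →ₗ[Aᵐᵒᵖ] M.1) (q : M.1 →ₗ[Aᵐᵒᵖ] M''.1),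
      Function.Injective i → Function.Exact i q → Function.Surjective q →
      φ M = φ M' + φ M'') :
    GrothendieckGroup F A C →+ G :=
  QuotientAddGroup.lift _ (FreeAbelianGroup.lift φ) (by
    rw [AddSubgroup.closure_le]
    rintro x ⟨M', M, M'', i, q, hi, hiq, hq, rfl⟩
    simp [AddMonoidHom.mem_ker, hφ M' M M'' i q hi hiq hq])

@[simp]
theorem GrothendieckGroup.lift_mk {C : FinRightMod.{w} F A → Prop} {G : Type*}
    [AddCommGroup G] (φ : {M : FinRightMod.{w} F A // C M} → G) (hφ) (M : FinRightMod.{w} F A)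
    (h : C M) : GrothendieckGroup.lift φ hφ (GrothendieckGroup.mk M h) = φ ⟨M, h⟩ := by
  change FreeAbelianGroup.lift φ (FreeAbelianGroup.of _) = _
  simp

theorem GrothendieckGroup.hom_ext {C : FinRightMod.{w} F A → Prop} {G : Type*} [AddCommGroup G]
    {φ ψ : GrothendieckGroup F A C →+ G}
    (h : ∀ M hM, φ (GrothendieckGroup.mk M hM) = ψ (GrothendieckGroup.mk M hM)) : φ = ψ := by
  refine QuotientAddGroup.addMonoidHom_ext _ (FreeAbelianGroup.lift_ext _ _ ?_)
  exact fun M => h M.1 M.2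

/-- The class `[M]` in `R₀(A)`. -/
abbrev R0.mk (M : FinRightMod.{w} F A) : R0.{w} F A := GrothendieckGroup.mk M trivial

/-- The class `[P]` in `K₀(A)` of a projective module. -/
abbrev K0.mk (P : FinRightMod.{w} F A) (hP : Module.Projective Aᵐᵒᵖ P) : K0.{w} F A :=
  GrothendieckGroup.mk P hP

end Classes

/-! ## The pairing between `K₀` and `R₀` -/

section Pairing

variable {F : Type*} {A : Type*} [Field F] [Ring A] [Algebra F A]

instance (M N : FinRightMod.{w} F A) : Module.Finite F (M →ₗ[Aᵐᵒᵖ] N) :=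
  Module.Finite.of_injective (LinearMap.restrictScalarsₗ F Aᵐᵒᵖ M N F)
    (LinearMap.restrictScalars_injective F)

/-- `dim Hom_A(P, V)`, as an integer. -/
noncomputable def homDim (P V : FinRightMod.{w} F A) : ℤ := Module.finrank F (P →ₗ[Aᵐᵒᵖ] V)

theorem homDim_add_right (P V' V V'' : FinRightMod.{w} F A) (hP : Module.Projective Aᵐᵒᵖ P)
    (i : V' →ₗ[Aᵐᵒᵖ] V) (q : V →ₗ[Aᵐᵒᵖ] V'') (hi : Function.Injective i)
    (hiq : Function.Exact i q) (hq : Function.Surjective q) :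
    homDim P V = homDim P V' + homDim P V'' := by
  let I : (P →ₗ[Aᵐᵒᵖ] V') →ₗ[F] (P →ₗ[Aᵐᵒᵖ] V) :=
    { toFun := fun f => i.comp f
      map_add' := fun f g => by ext; simp
      map_smul' := fun c f => by ext x; exact LinearMap.map_smul_of_tower i c (f x) }
  let Q : (P →ₗ[Aᵐᵒᵖ] V) →ₗ[F] (P →ₗ[Aᵐᵒᵖ] V'') :=
    { toFun := fun f => q.comp f
      map_add' := fun f g => by ext; simp
      map_smul' := fun c f => by ext x; exact LinearMap.map_smul_of_tower q c (f x) }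
  have hI : Function.Injective I := fun f g h => by
    ext x
    exact hi (LinearMap.congr_fun h x)
  have hQ : Function.Surjective Q := fun f => Module.projective_lifting_property q f hq
  have hIQ : LinearMap.range I = LinearMap.ker Q := by
    ext f
    constructor
    · rintro ⟨g, rfl⟩
      ext x
      exact (hiq _).2 ⟨g x, rfl⟩
    · intro hf
      have hf' : ∀ x, f x ∈ LinearMap.range i := fun x => (hiq _).1 (LinearMap.congr_fun hf x)
      refine ⟨(LinearEquiv.ofInjective i hi).symm.toLinearMap.comp (f.codRestrict _ hf'), ?_⟩
      ext x
      have := LinearEquiv.apply_symm_apply (LinearEquiv.ofInjective i hi) (f.codRestrict _ hf' x)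
      exact congrArg Subtype.val this
  have h := Q.finrank_range_add_finrank_ker
  rw [← hIQ, LinearMap.finrank_range_of_inj hI, LinearMap.range_eq_top.2 hQ, finrank_top] at h
  simp only [homDim]
  omega

theorem homDim_add_left (V P' P P'' : FinRightMod.{w} F A) (hP : Module.Projective Aᵐᵒᵖ P'')
    (i : P' →ₗ[Aᵐᵒᵖ] P) (q : P →ₗ[Aᵐᵒᵖ] P'') (hi : Function.Injective i)
    (hiq : Function.Exact i q) (hq : Function.Surjective q) :
    homDim P V = homDim P' V + homDim P'' V := by
  let I : (P →ₗ[Aᵐᵒᵖ] V) →ₗ[F] (P' →ₗ[Aᵐᵒᵖ] V) :=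
    { toFun := fun f => f.comp i
      map_add' := fun f g => by ext; simp
      map_smul' := fun c f => by ext x; rfl }
  let Q : (P'' →ₗ[Aᵐᵒᵖ] V) →ₗ[F] (P →ₗ[Aᵐᵒᵖ] V) :=
    { toFun := fun f => f.comp q
      map_add' := fun f g => by ext; simp
      map_smul' := fun c f => by ext x; rfl }
  obtain ⟨s, hs⟩ := Module.projective_lifting_property q LinearMap.id hq
  have hs' : ∀ x, q (s x) = x := fun x => LinearMap.congr_fun hs x
  have hmem : ∀ x, (LinearMap.id - s.comp q : P →ₗ[Aᵐᵒᵖ] P) x ∈ LinearMap.range i := fun x =>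
    (hiq _).1 (by simp [hs'])
  let r : P →ₗ[Aᵐᵒᵖ] P' := (LinearEquiv.ofInjective i hi).symm.toLinearMap.comp
    ((LinearMap.id - s.comp q : P →ₗ[Aᵐᵒᵖ] P).codRestrict _ hmem)
  have hr : ∀ x, i (r x) = x - s (q x) := fun x => by
    have := LinearEquiv.apply_symm_apply (LinearEquiv.ofInjective i hi)
      ((LinearMap.id - s.comp q : P →ₗ[Aᵐᵒᵖ] P).codRestrict _ hmem x)
    exact congrArg Subtype.val this
  have hqi : ∀ x, q (i x) = 0 := fun x => (hiq _).2 ⟨x, rfl⟩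
  have hri : ∀ x, r (i x) = x := fun x => hi (by simp [hr, hqi])
  have hQ : Function.Injective Q := fun f g h => by
    ext x
    obtain ⟨y, rfl⟩ := hq x
    exact LinearMap.congr_fun h y
  have hI : Function.Surjective I := fun f => ⟨f.comp r, by ext x; exact congrArg f (hri x)⟩
  have hIQ : LinearMap.range Q = LinearMap.ker I := by
    ext f
    constructor
    · rintro ⟨g, rfl⟩
      ext x
      change g (q (i x)) = 0
      simp [hqi]
    · intro hf
      refine ⟨f.comp s, ?_⟩
      ext x
      change f (s (q x)) = f x
      have h0 : f (i (r x)) = 0 := LinearMap.congr_fun hf (r x)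
      rw [hr, map_sub, sub_eq_zero] at h0
      exact h0.symm
  have h := I.finrank_range_add_finrank_ker
  rw [← hIQ, LinearMap.finrank_range_of_inj hQ, LinearMap.range_eq_top.2 hI, finrank_top] at h
  simp only [homDim]
  omega

variable (F A) in
/-- The pairing `⟨- | -⟩ : K₀(A) × R₀(A) → ℤ` with `⟨[P] | [V]⟩ = dim Hom_A(P, V)`. -/
noncomputable def grothendieckPairing : K0.{w} F A →+ R0.{w} F A →+ ℤ :=
  GrothendieckGroup.lift
    (fun P => GrothendieckGroup.lift (fun V => homDim P.1 V.1)
      fun V' V V'' i q => homDim_add_right P.1 V'.1 V.1 V''.1 P.2 i q)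
    fun P' P P'' i q hi hiq hq => GrothendieckGroup.hom_ext fun V hV => by
      simpa using homDim_add_left V P'.1 P.1 P''.1 P''.2 i q hi hiq hq

theorem grothendieckPairing_mk (P V : FinRightMod.{w} F A) (hP : Module.Projective Aᵐᵒᵖ P) :
    grothendieckPairing F A (K0.mk P hP) (R0.mk V) = Module.finrank F (P →ₗ[Aᵐᵒᵖ] V) := by
  simp [grothendieckPairing, homDim]

end Pairing

/-! ## Splitting fields, idempotents, projective indecomposable modules -/

/-- `F` is a splitting field for the finite-dimensional algebra `A`: every endomorphism of a simple
`A`-module is multiplication by a scalar of `F`. -/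
def IsSplittingFieldFor (F : Type*) (A : Type*) [Field F] [Ring A] [Algebra F A] : Prop :=
  ∀ S : FinRightMod.{w} F A, IsSimpleModule Aᵐᵒᵖ S →
    ∀ φ : S →ₗ[Aᵐᵒᵖ] S, ∃ c : F, ∀ x : S, φ x = c • x

/-- A primitive idempotent: a nonzero idempotent that is not the sum of two nonzero orthogonal
idempotents. -/
def IsPrimitiveIdempotent {A : Type*} [Ring A] (f : A) : Prop :=
  f ≠ 0 ∧ IsIdempotentElem f ∧ ∀ a b : A, IsIdempotentElem a → IsIdempotentElem b →
    a * b = 0 → b * a = 0 → a + b = f → a = 0 ∨ b = 0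

/-- A module is indecomposable if it is nonzero and not an internal direct sum of two nonzero
submodules. -/
def IsIndecomposableModule (B : Type*) (M : Type*) [Ring B] [AddCommGroup M] [Module B M] : Prop :=
  Nontrivial M ∧ ∀ N N' : Submodule B M, IsCompl N N' → N = ⊥ ∨ N' = ⊥

section RightIdeal

/-- The right ideal `aA`, as a right `A`-module. -/
noncomputable def FinRightMod.rightIdeal (F : Type*) {A : Type w} [Field F] [Ring A] [Algebra F A]
    [Module.Finite F A] (a : A) : FinRightMod.{w} F A where
  carrier := Submodule.span Aᵐᵒᵖ {a}
  finite := inferInstanceAs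
    (Module.Finite F ((Submodule.span Aᵐᵒᵖ {a}).restrictScalars F))

/-- For an idempotent `e` the right `A`-module `eA` is projective. -/
theorem projective_rightIdeal {F : Type*} {A : Type w} [Field F] [Ring A] [Algebra F A] [Module.Finite F A]
    {e : A} (he : IsIdempotentElem e) :
    Module.Projective Aᵐᵒᵖ (FinRightMod.rightIdeal F e) := by
  let N : Submodule Aᵐᵒᵖ A := Submodule.span Aᵐᵒᵖ {e}
  let q : A →ₗ[Aᵐᵒᵖ] N :=
    { toFun := fun x => ⟨e * x, Submodule.mem_span_singleton.2 ⟨MulOpposite.op x, rfl⟩⟩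
      map_add' := fun x y => Subtype.ext (mul_add e x y)
      map_smul' := fun c x => Subtype.ext (mul_assoc e x c.unop).symm }
  have h : q.comp N.subtype = LinearMap.id := by
    ext ⟨x, hx⟩
    obtain ⟨c, rfl⟩ := Submodule.mem_span_singleton.1 hx
    change e * (e * c.unop) = e * c.unop
    rw [← mul_assoc, he.eq]
  have hA : Module.Projective Aᵐᵒᵖ A :=
    Module.Projective.of_equiv
      ({ MulOpposite.opAddEquiv (α := A) with map_smul' := fun _ _ => rfl } :
        A ≃ₗ[Aᵐᵒᵖ] Aᵐᵒᵖ).symm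
  exact Module.Projective.of_split N.subtype q h

/-- The class `[eA] ∈ K₀(A)` of an idempotent `e`. -/
noncomputable def K0.ofIdempotent (F : Type*) {A : Type w} [Field F] [Ring A] [Algebra F A]
    [Module.Finite F A] (e : A) (he : IsIdempotentElem e) : K0.{w} F A :=
  K0.mk (FinRightMod.rightIdeal F e) (projective_rightIdeal he)

end RightIdeal

/-! ## Extension of scalars

`R'` is an `R`-algebra, `H` an `R`-algebra, and `S` an algebra over `R'`. A right
`R' ⊗[R] H`-module `L` yields the right `S ⊗[R] H`-module `S ⊗[R'] L`. -/

section BaseChange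

variable {R R' : Type*} (S : Type*) {H : Type*} [CommRing R] [CommRing R'] [CommRing S] [Ring H]
  [Algebra R R'] [Algebra R S] [Algebra R' S] [IsScalarTower R R' S] [Algebra R H]

/-- The canonical ring homomorphism `R' ⊗[R] H → S ⊗[R] H`, `r ⊗ h ↦ r ⊗ h`. -/
noncomputable def scalarExtensionMap (R R' S H : Type*) [CommRing R] [CommRing R'] [CommRing S]
    [Ring H] [Algebra R R'] [Algebra R S] [Algebra R' S] [IsScalarTower R R' S] [Algebra R H] :
    R' ⊗[R] H →ₐ[R] S ⊗[R] H :=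
  Algebra.TensorProduct.map (IsScalarTower.toAlgHom R R' S) (AlgHom.id R H)

/-- The right action of `S ⊗[R] H` on `S ⊗[R'] L`: the simple tensor `s ⊗ h` acts by
`t ⊗ l ↦ s t ⊗ l (1 ⊗ h)`. -/
noncomputable def baseChangeAction (L : FinRightMod.{w} R' (R' ⊗[R] H)) :
    (S ⊗[R] H)ᵐᵒᵖ →ₐ[S] Module.End S (S ⊗[R'] L) :=
  AlgHom.opComm <| Algebra.TensorProduct.lift (Algebra.ofId S _)
    (((AlgHom.opComm.symm ((Module.End.baseChangeHom R' S L).comp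
      (Algebra.lsmul (A := (R' ⊗[R] H)ᵐᵒᵖ) R' R' L))).restrictScalars R).comp Algebra.TensorProduct.includeRight)
    fun s _ => Algebra.commutes s _

theorem baseChangeAction_tmul (L : FinRightMod.{w} R' (R' ⊗[R] H)) (s t : S) (h : H) (l : L) :
    baseChangeAction S L (MulOpposite.op (s ⊗ₜ[R] h)) (t ⊗ₜ[R'] l) =
      (s * t) ⊗ₜ[R'] (MulOpposite.op ((1 : R') ⊗ₜ[R] h) • l) := by
  simp only [baseChangeAction, AlgHom.opComm]
  rfl

/-- The right `S ⊗[R] H`-module `S ⊗[R'] L` obtained from a right `R' ⊗[R] H`-module `L`. -/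
noncomputable def FinRightMod.baseChange {S' : Type u} [CommRing S'] [Algebra R S'] [Algebra R' S']
    [IsScalarTower R R' S'] (L : FinRightMod.{v} R' (R' ⊗[R] H)) :
    FinRightMod.{max u v} S' (S' ⊗[R] H) :=
  letI : Module (S' ⊗[R] H)ᵐᵒᵖ (S' ⊗[R'] L) :=
    Module.compHom _ (baseChangeAction S' L).toRingHom
  { carrier := S' ⊗[R'] L
    isScalarTower := IsScalarTower.of_algebraMap_smul fun s x => by
      change baseChangeAction S' L (algebraMap S' _ s) x = s • x
      rw [AlgHom.commutes]
      rfl }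

end BaseChange

/-! ## The decomposition map and its dual

`R` is a ring, `R'` an `R`-algebra with two algebras `K` and `k` over it that are fields, and `H` is
an `R`-algebra; in the application `R'` is the localisation of `R` at a nonzero prime ideal,
`K` its field of fractions and `k` its residue field. -/

section Decomposition

variable (R : Type u) (R' : Type u) (K : Type u) (k : Type u) (H : Type v)
  [CommRing R] [CommRing R'] [Field K] [Field k] [Ring H]
  [Algebra R R'] [Algebra R K] [Algebra R k] [Algebra R' K] [Algebra R' k]
  [IsScalarTower R R' K] [IsScalarTower R R' k] [Algebra R H]

/-- `d` is the decomposition map: for every simple right `KH`-module `V` and every right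
`R'H`-module `L`, finitely generated and free over `R'`, with `K ⊗ L ≅ V`, it sends
`[V]` to `[k ⊗ L]`. -/
def IsDecompositionMap
    (d : R0.{max u v} K (K ⊗[R] H) →+ R0.{max u v} k (k ⊗[R] H)) : Prop :=
  ∀ V : FinRightMod.{max u v} K (K ⊗[R] H), IsSimpleModule (K ⊗[R] H)ᵐᵒᵖ V →
    ∀ L : FinRightMod.{max u v} R' (R' ⊗[R] H), Module.Free R' L →
      Nonempty (FinRightMod.baseChange (S' := K) L ≃ₗ[(K ⊗[R] H)ᵐᵒᵖ] V) →
      d (R0.mk V) = R0.mk (FinRightMod.baseChange (S' := k) L)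

/-- `e` is the map given by lifting primitive idempotents: for every primitive idempotent
`f ∈ kH` and every idempotent `g ∈ R'H` that is mapped to `f`, it sends `[f kH]` to `[g KH]`. -/
def IsIdempotentLiftMap [Module.Finite R H]
    (e : K0.{max u v} k (k ⊗[R] H) →+ K0.{max u v} K (K ⊗[R] H)) : Prop :=
  ∀ (f : k ⊗[R] H) (hf : IsPrimitiveIdempotent f)
    (g : R' ⊗[R] H) (hg : IsIdempotentElem g), scalarExtensionMap R R' k H g = f →
      e (K0.ofIdempotent k f hf.2.1) =
        K0.ofIdempotent K (scalarExtensionMap R R' K H g) (hg.map (scalarExtensionMap R R' K H))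

end Decomposition

/-! ## Matrices with respect to simple modules and projective indecomposable modules -/

/-- `S` is a complete system of representatives of the isomorphism classes of simple right
`A`-modules, and `P i` is a projective indecomposable module with head
`P i / rad (P i)` isomorphic to `S i`. -/
structure IsSimplePIMSystem {F : Type*} {A : Type*} [Field F] [Ring A] [Algebra F A] {ι : Type*}
    (S P : ι → FinRightMod.{w} F A) : Prop where
  simple : ∀ i, IsSimpleModule Aᵐᵒᵖ (S i)
  eq_of_equiv : ∀ i j, Nonempty (S i ≃ₗ[Aᵐᵒᵖ] S j) → i = j
  complete : ∀ M : FinRightMod.{w} F A, IsSimpleModule Aᵐᵒᵖ M →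
    ∃ i, Nonempty (M ≃ₗ[Aᵐᵒᵖ] S i)
  projective : ∀ i, Module.Projective Aᵐᵒᵖ (P i)
  indecomposable : ∀ i, IsIndecomposableModule Aᵐᵒᵖ (P i)
  head : ∀ i, Nonempty ((P i ⧸ Module.jacobson Aᵐᵒᵖ (P i)) ≃ₗ[Aᵐᵒᵖ] S i)

/-- The matrix of `φ` in row convention: row `i` holds the coordinates of `φ (b i)` with respect to
the basis `b'`. -/
noncomputable def rowMatrix {ι κ M N : Type*} [AddCommGroup M] [AddCommGroup N]
    (b : Module.Basis ι ℤ M) (b' : Module.Basis κ ℤ N) (φ : M →+ N) : Matrix ι κ ℤ :=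
  Matrix.of fun i j => b'.repr (φ (b i)) j

/-!
Over a splitting field `F` the modules `P i` and `S j` satisfy `dim Hom(P i, S j) = δ i j`
(`IsSimplePIMSystem.homDim_eq`), because `P i` has a unique maximal submodule and the endomorphisms
of `S i` are scalars. As simple modules generate `R₀` and indecomposable projective ones generate
`K₀`, both families of classes are bases, dual to each other under the pairing; thus an element of
`R₀` or `K₀` is known once its pairings with the dual basis are.

Let `R'` be the local ring, `g` an idempotent of `R'H`, and `L` a right `R'H`-module that is free of
finite rank over `R'`. Then `dim Hom(g KH, K ⊗ L)` and `dim Hom(g kH, k ⊗ L)` both equal the rank of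
`L g` (`homDim_rightIdeal_baseChange`). Choosing a lattice `L i` in each simple `KH`-module `S i`, and
an idempotent `g j` above each of the primitive idempotents `f j` that represent the projective
indecomposable `kH`-modules, put `d [S i] = [k ⊗ L i]` and `e [f j kH] = [g j KH]`. The equality of
ranks says that `d` and `e` are dual to each other, and combined with the duality of the bases it
shows that neither map depends on the choices.

The point that needs an argument is that idempotents of `kH` lift to `R'H` although `R'` is not
complete (`exists_isIdempotentElem_scalarExtensionMap_eq`); this is where the splitting of `KH` is
used. Modulo a nilpotent ideal `KH` is a product of matrix algebras over `K`, and on suitable lattices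
`R'H` maps to the corresponding product `Γ` of matrix algebras over `R'`, the image containing `s Γ`
for some `s ≠ 0`. Idempotents of `Γ / πΓ` lift to `Γ` by diagonalisation over the residue field. An
element of `R'H` that is idempotent modulo a high power of `π` is therefore congruent, modulo that
power, to an idempotent of `Γ`, which then lies in the image of `R'H` and lifts along the nil kernel.
The lift may miss the given idempotent of `kH` by a nilpotent ideal, which is corrected by conjugation
(`exists_isIdempotentElem_sub_eq_smul`).
-/

/-! ### Generators of the Grothendieck groups -/

section GrothendieckGenerators

variable {F : Type*} {A : Type*} [CommRing F] [Ring A] [Algebra F A]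

theorem GrothendieckGroup.mk_eq_add {C : FinRightMod.{w} F A → Prop} {M' M M'' : FinRightMod.{w} F A}
    (h' : C M') (h : C M) (h'' : C M'') (i : M' →ₗ[Aᵐᵒᵖ] M) (q : M →ₗ[Aᵐᵒᵖ] M'')
    (hi : Function.Injective i) (hiq : Function.Exact i q) (hq : Function.Surjective q) :
    (mk M h : GrothendieckGroup F A C) = mk M' h' + mk M'' h'' := by
  have key : (QuotientAddGroup.mk (FreeAbelianGroup.of ⟨M, h⟩ - FreeAbelianGroup.of ⟨M', h'⟩ -
      FreeAbelianGroup.of ⟨M'', h''⟩) : GrothendieckGroup F A C) = 0 :=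
    (QuotientAddGroup.eq_zero_iff _).2
      (AddSubgroup.subset_closure ⟨⟨M', h'⟩, ⟨M, h⟩, ⟨M'', h''⟩, i, q, hi, hiq, hq, rfl⟩)
  have key' : (mk M h : GrothendieckGroup F A C) - mk M' h' - mk M'' h'' = 0 := key
  rw [sub_sub, sub_eq_zero] at key'
  exact key'

theorem GrothendieckGroup.mk_eq_zero {C : FinRightMod.{w} F A → Prop} {M : FinRightMod.{w} F A}
    (h : C M) [Subsingleton M] : (mk M h : GrothendieckGroup F A C) = 0 := by
  have := mk_eq_add h h h (LinearMap.id : M →ₗ[Aᵐᵒᵖ] M) (LinearMap.id : M →ₗ[Aᵐᵒᵖ] M)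
    Function.injective_id (fun x => by simp [Subsingleton.elim x 0]) Function.surjective_id
  simpa using this

/-- The classes `[M]` generate the Grothendieck group. -/
theorem GrothendieckGroup.eq_top_of_mk_mem {C : FinRightMod.{w} F A → Prop}
    {G : AddSubgroup (GrothendieckGroup F A C)} (h : ∀ M hM, mk M hM ∈ G) : G = ⊤ := by
  have : QuotientAddGroup.mk' G = 0 := GrothendieckGroup.hom_ext fun M hM =>
    (QuotientAddGroup.eq_zero_iff _).2 (h M hM)
  refine eq_top_iff.2 fun x _ => (QuotientAddGroup.eq_zero_iff x).1 ?_
  exact DFunLike.congr_fun this x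

/-- The zero module. -/
def FinRightMod.zero (F : Type*) (A : Type*) [CommRing F] [Ring A] [Algebra F A] :
    FinRightMod.{w} F A where
  carrier := PUnit

instance : Subsingleton (FinRightMod.zero.{w} F A) := inferInstanceAs (Subsingleton PUnit)

theorem GrothendieckGroup.mk_congr {C : FinRightMod.{w} F A → Prop}
    (h0 : C (FinRightMod.zero F A)) {M N : FinRightMod.{w} F A} (hM : C M) (hN : C N)
    (e : M ≃ₗ[Aᵐᵒᵖ] N) : (mk M hM : GrothendieckGroup F A C) = mk N hN := by
  have := mk_eq_add h0 hM hN (0 : FinRightMod.zero F A →ₗ[Aᵐᵒᵖ] M) e.toLinearMap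
    (Function.injective_of_subsingleton _) (fun x => by simp [eq_comm (a := x)]) e.surjective
  rwa [mk_eq_zero h0, zero_add] at this

theorem R0.mk_congr {M N : FinRightMod.{w} F A} (e : M ≃ₗ[Aᵐᵒᵖ] N) : R0.mk M = R0.mk N :=
  GrothendieckGroup.mk_congr trivial _ _ e

theorem K0.mk_congr {M N : FinRightMod.{w} F A} (hM : Module.Projective Aᵐᵒᵖ M)
    (hN : Module.Projective Aᵐᵒᵖ N) (e : M ≃ₗ[Aᵐᵒᵖ] N) : K0.mk M hM = K0.mk N hN :=
  GrothendieckGroup.mk_congr (inferInstanceAs (Module.Projective Aᵐᵒᵖ PUnit.{w + 1})) _ _ e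

end GrothendieckGenerators

section FiniteDimensional

variable {F : Type*} {A : Type*} [Field F] [Ring A] [Algebra F A]

/-- A submodule of a finite-dimensional right module. -/
abbrev FinRightMod.ofSubmodule (M : FinRightMod.{w} F A) (N : Submodule Aᵐᵒᵖ M) :
    FinRightMod.{w} F A where
  carrier := N
  finite := inferInstanceAs (Module.Finite F (N.restrictScalars F))

/-- A quotient of a finite-dimensional right module. -/
abbrev FinRightMod.ofQuotient (M : FinRightMod.{w} F A) (N : Submodule Aᵐᵒᵖ M) :
    FinRightMod.{w} F A where
  carrier := M ⧸ N
  finite := Module.Finite.of_surjective (N.mkQ.restrictScalars F) N.mkQ_surjective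

instance (M : FinRightMod.{w} F A) : IsNoetherian Aᵐᵒᵖ M := isNoetherian_of_tower F inferInstance

instance (M : FinRightMod.{w} F A) : IsArtinian Aᵐᵒᵖ M := isArtinian_of_tower F inferInstance

theorem FinRightMod.finrank_ofSubmodule_lt (M : FinRightMod.{w} F A) {N : Submodule Aᵐᵒᵖ M}
    (hN : N ≠ ⊤) : Module.finrank F (M.ofSubmodule N) < Module.finrank F M :=
  Submodule.finrank_lt (s := N.restrictScalars F) (by simpa using hN)

theorem FinRightMod.isSimpleModule_ofQuotient (M : FinRightMod.{w} F A) {N : Submodule Aᵐᵒᵖ M}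
    (hN : IsCoatom N) : IsSimpleModule Aᵐᵒᵖ (M.ofQuotient N) :=
  isSimpleModule_iff_isCoatom.2 hN

/-- By induction on a composition series, the classes of the simple modules generate `R₀(A)`. -/
theorem R0.eq_top_of_simple_mem {G : AddSubgroup (R0.{w} F A)}
    (h : ∀ S : FinRightMod.{w} F A, IsSimpleModule Aᵐᵒᵖ S → R0.mk S ∈ G) : G = ⊤ := by
  refine GrothendieckGroup.eq_top_of_mk_mem fun M _ => ?_
  induction hn : Module.finrank F M using Nat.strong_induction_on generalizing M with
  | _ n ih =>
    subst hn
    rcases subsingleton_or_nontrivial M with hM | hM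
    · rw [GrothendieckGroup.mk_eq_zero]
      exact zero_mem G
    · obtain ⟨N, hN⟩ := IsCoatomic.exists_coatom (Submodule Aᵐᵒᵖ M)
      rw [GrothendieckGroup.mk_eq_add (M' := M.ofSubmodule N) (M'' := M.ofQuotient N) trivial trivial
        trivial N.subtype N.mkQ N.injective_subtype (LinearMap.exact_subtype_mkQ N)
        N.mkQ_surjective]
      exact add_mem (ih _ (M.finrank_ofSubmodule_lt hN.1) (M.ofSubmodule N) rfl)
        (h _ (M.isSimpleModule_ofQuotient hN))

/-- Every projective module is a direct sum of indecomposable ones, whose classes therefore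
generate `K₀(A)`. -/
theorem K0.eq_top_of_indecomposable_mem {G : AddSubgroup (K0.{w} F A)}
    (h : ∀ (P : FinRightMod.{w} F A) (hP : Module.Projective Aᵐᵒᵖ P),
      IsIndecomposableModule Aᵐᵒᵖ P → K0.mk P hP ∈ G) : G = ⊤ := by
  refine GrothendieckGroup.eq_top_of_mk_mem fun M hM => ?_
  induction hn : Module.finrank F M using Nat.strong_induction_on generalizing M with
  | _ n ih =>
    subst hn
    rcases subsingleton_or_nontrivial M with hM' | hM'
    · rw [GrothendieckGroup.mk_eq_zero]
      exact zero_mem G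
    by_cases hi : IsIndecomposableModule Aᵐᵒᵖ M
    · exact h M hM hi
    simp only [IsIndecomposableModule, hM', true_and, not_forall, not_or] at hi
    obtain ⟨N, N', hc, hN, hN'⟩ := hi
    have proj : ∀ {X Y : Submodule Aᵐᵒᵖ M}, IsCompl X Y →
        Module.Projective Aᵐᵒᵖ (M.ofSubmodule X) := fun {X Y} hXY =>
      Module.Projective.of_split (P := X) X.subtype (X.projectionOnto Y hXY)
        (Submodule.projectionOnto_comp_subtype hXY)
    have lt : ∀ {X Y : Submodule Aᵐᵒᵖ M}, IsCompl X Y → Y ≠ ⊥ → X ≠ ⊤ := by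
      rintro X Y hXY hY rfl
      exact hY (by simpa using hXY.inf_eq_bot)
    rw [GrothendieckGroup.mk_eq_add (M' := M.ofSubmodule N) (M'' := M.ofSubmodule N') (proj hc) hM
      (proj hc.symm) N.subtype (N'.projectionOnto N hc.symm) N.injective_subtype
      (fun x => by
        
        rw [Submodule.projectionOnto_apply_eq_zero_iff hc.symm, ← SetLike.mem_coe]
        simp)
      (Submodule.projectionOnto_surjective hc.symm)]
    exact add_mem (ih _ (M.finrank_ofSubmodule_lt (lt hc hN')) _ (proj hc) rfl)
      (ih _ (M.finrank_ofSubmodule_lt (lt hc.symm hN)) _ (proj hc.symm) rfl)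

end FiniteDimensional

/-! ### Indecomposable projective modules -/

section Indecomposable

variable {B M N S : Type*} [Ring B] [AddCommGroup M] [Module B M] [AddCommGroup N] [Module B N]
  [AddCommGroup S] [Module B S]

/-- By Fitting's lemma, an endomorphism of an indecomposable module that induces the identity on
a nonzero quotient is not nilpotent, hence bijective. -/
theorem IsIndecomposableModule.bijective_of_comp_eq [IsNoetherian B M] [IsArtinian B M]
    (hM : IsIndecomposableModule B M) [Nontrivial S] {q : M →ₗ[B] S} (hq : Function.Surjective q)
    {f : M →ₗ[B] M} (hf : q ∘ₗ f = q) : Function.Bijective f := by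
  obtain ⟨n, hc, hn⟩ := (f.eventually_isCompl_ker_pow_range_pow.and
    (Filter.eventually_ge_atTop 1)).exists
  have hqn : ∀ m : ℕ, q ∘ₗ (f ^ m) = q := by
    intro m
    induction m with
    | zero => rfl
    | succ m ih => rw [pow_succ, Module.End.mul_eq_comp, ← LinearMap.comp_assoc, ih, hf]
  rcases hM.2 _ _ hc with h | h
  · refine IsArtinian.bijective_of_injective_endomorphism f ?_
    rw [← LinearMap.ker_eq_bot, eq_bot_iff, ← h]
    intro x hx
    obtain ⟨m, rfl⟩ := Nat.exists_eq_add_of_le' hn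
    rw [LinearMap.mem_ker] at hx ⊢
    rw [pow_succ, Module.End.mul_apply, hx, map_zero]
  · have h0 : f ^ n = 0 := LinearMap.range_eq_bot.1 h
    have := hqn n
    rw [h0, LinearMap.comp_zero] at this
    obtain ⟨s, hs⟩ := exists_ne (0 : S)
    obtain ⟨x, rfl⟩ := hq s
    rw [← this] at hs
    exact absurd rfl hs

/-- An indecomposable projective module is determined by any nonzero quotient of it. -/
theorem IsIndecomposableModule.nonempty_equiv [IsNoetherian B M] [IsArtinian B M]
    [IsNoetherian B N] [IsArtinian B N] [Module.Projective B M] [Module.Projective B N]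
    (hM : IsIndecomposableModule B M) (hN : IsIndecomposableModule B N) [Nontrivial S]
    {q : M →ₗ[B] S} (hq : Function.Surjective q) {r : N →ₗ[B] S} (hr : Function.Surjective r) :
    Nonempty (M ≃ₗ[B] N) := by
  obtain ⟨f, hf⟩ := Module.projective_lifting_property r q hr
  obtain ⟨g, hg⟩ := Module.projective_lifting_property q r hq
  have h1 : Function.Bijective (g ∘ₗ f) := hM.bijective_of_comp_eq hq (by
    rw [← LinearMap.comp_assoc, hg, hf])
  have h2 : Function.Bijective (f ∘ₗ g) := hN.bijective_of_comp_eq hr (by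
    rw [← LinearMap.comp_assoc, hf, hg])
  exact ⟨LinearEquiv.ofBijective f
    ⟨Function.Injective.of_comp h1.1, Function.Surjective.of_comp h2.2⟩⟩

/-- The kernel of a surjection from an indecomposable projective module onto a simple one contains
every proper submodule. -/
theorem IsIndecomposableModule.le_ker [IsNoetherian B M] [IsArtinian B M] [Module.Projective B M]
    (hM : IsIndecomposableModule B M) [IsSimpleModule B S] {q : M →ₗ[B] S}
    (hq : Function.Surjective q) {X : Submodule B M} (hX : X ≠ ⊤) : X ≤ LinearMap.ker q := by
  by_contra hXq
  have : Nontrivial S := IsSimpleModule.nontrivial B S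
  have hs : Function.Surjective (q ∘ₗ X.subtype) := by
    refine LinearMap.surjective_of_ne_zero fun h => hXq fun x hx => ?_
    exact LinearMap.congr_fun h ⟨x, hx⟩
  obtain ⟨h, hh⟩ := Module.projective_lifting_property _ q hs
  have := hM.bijective_of_comp_eq hq (f := X.subtype ∘ₗ h) (by
    rw [← LinearMap.comp_assoc, hh])
  refine hX (eq_top_iff.2 fun y _ => ?_)
  obtain ⟨x, rfl⟩ := this.2 y
  exact (h x).2

theorem IsIndecomposableModule.jacobson_eq_ker [IsNoetherian B M] [IsArtinian B M]
    [Module.Projective B M] (hM : IsIndecomposableModule B M) [IsSimpleModule B S] {q : M →ₗ[B] S}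
    (hq : Function.Surjective q) : Module.jacobson B M = LinearMap.ker q := by
  have hc : IsCoatom (LinearMap.ker q) := by
    rw [← isSimpleModule_iff_isCoatom]
    exact IsSimpleModule.congr (q.quotKerEquivOfSurjective hq)
  refine le_antisymm (sInf_le hc) (le_sInf fun X hX => ?_)
  exact (hX.le_iff_eq hc.1).1 (hM.le_ker hq hX.1) |>.le

end Indecomposable

/-! ### Bases given by simple and projective indecomposable modules -/

section PIM

variable {F : Type*} {A : Type*} [Field F] [Ring A] [Algebra F A]

namespace IsSimplePIMSystem

variable {ι : Type*} {S P : ι → FinRightMod.{w} F A} (h : IsSimplePIMSystem S P)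

include h

theorem exists_surjective (i : ι) : ∃ q : P i →ₗ[Aᵐᵒᵖ] S i, Function.Surjective q := by
  obtain ⟨e⟩ := h.head i
  exact ⟨e.toLinearMap ∘ₗ Submodule.mkQ _, e.surjective.comp (Submodule.mkQ_surjective _)⟩

/-- `dim Hom_A(P i, S j) = δ i j`: a nonzero map `P i → S j` factors through the head `S i`, and
the endomorphisms of `S i` are scalars. -/
theorem homDim_eq [DecidableEq ι] (hA : IsSplittingFieldFor.{w} F A) (i j : ι) :
    homDim (P i) (S j) = if i = j then 1 else 0 := by
  have := h.projective i
  have := h.simple i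
  have := h.simple j
  have hP := h.indecomposable i
  obtain ⟨q, hq⟩ := h.exists_surjective i
  unfold homDim
  split_ifs with hij
  · subst hij
    rw [Nat.cast_eq_one, finrank_eq_one_iff']
    refine ⟨q, ?_, fun φ => ?_⟩
    · have : Nontrivial (S i) := IsSimpleModule.nontrivial Aᵐᵒᵖ (S i)
      rintro rfl
      obtain ⟨s, hs⟩ := exists_ne (0 : S i)
      obtain ⟨x, rfl⟩ := hq s
      exact hs rfl
    · by_cases hφ : φ = 0
      · exact ⟨0, by simp [hφ]⟩
      have hle : LinearMap.ker q ≤ LinearMap.ker φ := by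
        rw [← hP.jacobson_eq_ker hq, hP.jacobson_eq_ker (LinearMap.surjective_of_ne_zero hφ)]
      obtain ⟨c, hc⟩ := hA (S i) (h.simple i) (((LinearMap.ker q).liftQ φ hle) ∘ₗ
        (q.quotKerEquivOfSurjective hq).symm.toLinearMap)
      refine ⟨c, LinearMap.ext fun x => ?_⟩
      have := hc (q x)
      have h2 : (q.quotKerEquivOfSurjective hq).symm (q x) = Submodule.Quotient.mk x := by
        rw [LinearEquiv.symm_apply_eq]; rfl
      simp only [LinearMap.comp_apply, LinearEquiv.coe_coe, h2] at this
      exact this.symm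
  · rw [Nat.cast_eq_zero]
    have h0 : ∀ φ : P i →ₗ[Aᵐᵒᵖ] S j, φ = 0 := fun φ => by
      by_contra hφ
      have hs := LinearMap.surjective_of_ne_zero hφ
      refine hij (h.eq_of_equiv i j ⟨(q.quotKerEquivOfSurjective hq).symm.trans
        ((Submodule.quotEquivOfEq _ _ ?_).trans (φ.quotKerEquivOfSurjective hs))⟩)
      rw [← hP.jacobson_eq_ker hq, hP.jacobson_eq_ker hs]
    have : Subsingleton (P i →ₗ[Aᵐᵒᵖ] S j) := ⟨fun a b => by rw [h0 a, h0 b]⟩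
    exact Module.finrank_zero_of_subsingleton

theorem pairing_eq [DecidableEq ι] (hA : IsSplittingFieldFor.{w} F A) (i j : ι) :
    grothendieckPairing F A (K0.mk (P i) (h.projective i)) (R0.mk (S j)) =
      if i = j then 1 else 0 := by
  rw [grothendieckPairing_mk]
  exact h.homDim_eq hA i j

/-- The classes of the simple modules form a basis of `R₀(A)`. -/
noncomputable def basisR0 (hA : IsSplittingFieldFor.{w} F A) : Module.Basis ι ℤ (R0.{w} F A) :=
  Module.Basis.mk (v := fun i => R0.mk (S i))
    (by
      classical
      rw [linearIndependent_iff']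
      intro s g hg i hi
      have := congrArg (grothendieckPairing F A (K0.mk (P i) (h.projective i))) hg
      simpa [h.pairing_eq hA, hi] using this)
    (by
      suffices (Submodule.span ℤ (Set.range fun i => R0.mk (S i))).toAddSubgroup = ⊤ from
        fun x _ => by
          have hx : x ∈ (⊤ : AddSubgroup (R0.{w} F A)) := trivial
          rwa [← this] at hx
      refine R0.eq_top_of_simple_mem fun M hM => ?_
      obtain ⟨i, ⟨e⟩⟩ := h.complete M hM
      rw [R0.mk_congr e]
      exact Submodule.subset_span ⟨i, rfl⟩)

/-- The classes of the projective indecomposable modules form a basis of `K₀(A)`. -/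
noncomputable def basisK0 (hA : IsSplittingFieldFor.{w} F A) : Module.Basis ι ℤ (K0.{w} F A) :=
  Module.Basis.mk (v := fun i => K0.mk (P i) (h.projective i))
    (by
      classical
      rw [linearIndependent_iff']
      intro s g hg i hi
      have := congrArg (fun x => grothendieckPairing F A x (R0.mk (S i))) hg
      simpa [h.pairing_eq hA, hi, AddMonoidHom.finsetSum_apply] using this)
    (by
      suffices (Submodule.span ℤ (Set.range fun i => K0.mk (P i) (h.projective i))).toAddSubgroup
          = ⊤ from
        fun x _ => by
          have hx : x ∈ (⊤ : AddSubgroup (K0.{w} F A)) := trivial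
          rwa [← this] at hx
      refine K0.eq_top_of_indecomposable_mem fun M hM hMi => ?_
      have := hMi.1
      obtain ⟨N, hN⟩ := IsCoatomic.exists_coatom (Submodule Aᵐᵒᵖ M)
      obtain ⟨i, ⟨e⟩⟩ := h.complete _ (M.isSimpleModule_ofQuotient hN)
      obtain ⟨q, hq⟩ := h.exists_surjective i
      have := h.projective i
      have := h.simple i
      have : Nontrivial (S i) := IsSimpleModule.nontrivial Aᵐᵒᵖ (S i)
      obtain ⟨e'⟩ := hMi.nonempty_equiv (h.indecomposable i) (q := e.toLinearMap ∘ₗ N.mkQ)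
        (e.surjective.comp N.mkQ_surjective) hq
      rw [K0.mk_congr hM (h.projective i) e']
      exact Submodule.subset_span ⟨i, rfl⟩)

theorem basisR0_apply (hA : IsSplittingFieldFor.{w} F A) (i : ι) :
    h.basisR0 hA i = R0.mk (S i) := Module.Basis.mk_apply ..

theorem basisK0_apply (hA : IsSplittingFieldFor.{w} F A) (i : ι) :
    h.basisK0 hA i = K0.mk (P i) (h.projective i) := Module.Basis.mk_apply ..

theorem basisR0_repr (hA : IsSplittingFieldFor.{w} F A) (y : R0.{w} F A) (i : ι) :
    (h.basisR0 hA).repr y i = grothendieckPairing F A (K0.mk (P i) (h.projective i)) y := by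
  classical
  have : (h.basisR0 hA).coord i =
      (grothendieckPairing F A (K0.mk (P i) (h.projective i))).toIntLinearMap :=
    (h.basisR0 hA).ext fun j => by
      rw [Module.Basis.coord_apply, Module.Basis.repr_self, Finsupp.single_apply,
        AddMonoidHom.coe_toIntLinearMap, h.basisR0_apply, h.pairing_eq hA]
      simp [eq_comm]
  exact LinearMap.congr_fun this y

theorem basisK0_repr (hA : IsSplittingFieldFor.{w} F A) (x : K0.{w} F A) (i : ι) :
    (h.basisK0 hA).repr x i = grothendieckPairing F A x (R0.mk (S i)) := by
  classical
  have : (h.basisK0 hA).coord i =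
      ((grothendieckPairing F A).flip (R0.mk (S i))).toIntLinearMap :=
    (h.basisK0 hA).ext fun j => by
      rw [Module.Basis.coord_apply, Module.Basis.repr_self, Finsupp.single_apply,
        AddMonoidHom.coe_toIntLinearMap, h.basisK0_apply, AddMonoidHom.flip_apply, h.pairing_eq hA]
  exact LinearMap.congr_fun this x

end IsSimplePIMSystem

end PIM

/-! ### Primitive idempotents -/

section Idempotents

variable {F : Type u} {A : Type w} [Field F] [Ring A] [Algebra F A] [Module.Finite F A]

theorem IsIdempotentElem.mem_span_op_iff {e : A} (he : IsIdempotentElem e) {x : A} :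
    x ∈ Submodule.span Aᵐᵒᵖ {e} ↔ e * x = x := by
  rw [Submodule.mem_span_singleton]
  constructor
  · rintro ⟨c, rfl⟩
    change e * (e * c.unop) = e * c.unop
    rw [← mul_assoc, he.eq]
  · intro h
    exact ⟨MulOpposite.op x, h⟩

/-- `Hom_A(eA, V)` is isomorphic to `V e` by evaluation at `e`. -/
theorem homDim_rightIdeal {e : A} (he : IsIdempotentElem e) (V : FinRightMod.{w} F A) :
    homDim (FinRightMod.rightIdeal F e) V =
      Module.finrank F (LinearMap.range (Algebra.lsmul F F V (MulOpposite.op e))) := by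
  let N : Submodule Aᵐᵒᵖ A := Submodule.span Aᵐᵒᵖ {e}
  let e' : N := ⟨e, Submodule.mem_span_singleton_self e⟩
  have hcoe : ∀ x : N, MulOpposite.op (x : A) • e' = x := fun x =>
    Subtype.ext (he.mem_span_op_iff.1 x.2)
  have hee : MulOpposite.op e • e' = e' := hcoe e'
  let ψ : (N →ₗ[Aᵐᵒᵖ] V) →ₗ[F] LinearMap.range (Algebra.lsmul F F V (MulOpposite.op e)) :=
    { toFun := fun φ => ⟨φ e', φ e', by
        change MulOpposite.op e • φ e' = φ e'
        rw [← map_smul, hee]⟩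
      map_add' := fun _ _ => rfl
      map_smul' := fun _ _ => rfl }
  have hinj : Function.Injective ψ := fun φ φ' h => LinearMap.ext fun x => by
    rw [← hcoe x, map_smul, map_smul]
    exact congrArg _ (congrArg Subtype.val h)
  have hsurj : Function.Surjective ψ := by
    rintro ⟨_, v, rfl⟩
    refine ⟨{ toFun := fun x => MulOpposite.op (x : A) • v
              map_add' := fun x y => by simp [add_smul]
              map_smul' := fun c x => by
                change MulOpposite.op ((x : A) * c.unop) • v = c • _
                rw [MulOpposite.op_mul, mul_smul]; rfl }, rfl⟩
  exact congrArg Nat.cast (LinearEquiv.finrank_eq (LinearEquiv.ofBijective ψ ⟨hinj, hsurj⟩))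

/-- A decomposition `eA = N ⊕ N'` gives a decomposition of `e` into orthogonal idempotents. -/
theorem IsPrimitiveIdempotent.isIndecomposableModule {e : A} (he : IsPrimitiveIdempotent e) :
    IsIndecomposableModule Aᵐᵒᵖ (FinRightMod.rightIdeal F e) := by
  let M : Submodule Aᵐᵒᵖ A := Submodule.span Aᵐᵒᵖ {e}
  change IsIndecomposableModule Aᵐᵒᵖ M
  let e' : M := ⟨e, Submodule.mem_span_singleton_self e⟩
  refine ⟨⟨e', 0, fun h => he.1 (congrArg Subtype.val h)⟩, fun N N' hc => ?_⟩
  have top : ∀ X : Submodule Aᵐᵒᵖ M, e' ∈ X → X = ⊤ := fun X hX => eq_top_iff.2 fun x _ => by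
    have : MulOpposite.op (x : A) • e' = x := Subtype.ext (he.2.1.mem_span_op_iff.1 x.2)
    rw [← this]
    exact X.smul_mem _ hX
  obtain ⟨a, b, hab⟩ : ∃ (a : N) (b : N'), (a : M) + b = e' := by
    have : e' ∈ N ⊔ N' := by rw [hc.sup_eq_top]; trivial
    obtain ⟨a, ha, b, hb, h⟩ := Submodule.mem_sup.1 this
    exact ⟨⟨a, ha⟩, ⟨b, hb⟩, h⟩
  have hab' : ((a : M) : A) + ((b : M) : A) = e := congrArg Subtype.val hab
  have hdisj : ∀ x : M, x ∈ N → x ∈ N' → x = 0 := fun x h h' =>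
    (Submodule.disjoint_def.1 hc.disjoint) x h h'
  have ha : ((a : M) : A) * (a : M) = (a : M) ∧ ((b : M) : A) * (a : M) = 0 := by
    have h1 : (a : M) - MulOpposite.op ((a : M) : A) • (a : M) =
        MulOpposite.op ((a : M) : A) • (b : M) := Subtype.ext (by
      change ((a : M) : A) - (a : M) * (a : M) = (b : M) * (a : M)
      have := he.2.1.mem_span_op_iff.1 (a : M).2
      rw [← hab', add_mul] at this
      rw [sub_eq_iff_eq_add, add_comm, this])
    have h0 := hdisj _ (h1 ▸ N.sub_mem a.2 (N.smul_mem _ a.2)) 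
      (N'.smul_mem (MulOpposite.op ((a : M) : A)) b.2)
    rw [h0, sub_eq_zero] at h1
    exact ⟨(congrArg Subtype.val h1).symm, congrArg Subtype.val h0⟩
  have hb : ((b : M) : A) * (b : M) = (b : M) ∧ ((a : M) : A) * (b : M) = 0 := by
    have h1 : (b : M) - MulOpposite.op ((b : M) : A) • (b : M) =
        MulOpposite.op ((b : M) : A) • (a : M) := Subtype.ext (by
      change ((b : M) : A) - (b : M) * (b : M) = (a : M) * (b : M)
      have := he.2.1.mem_span_op_iff.1 (b : M).2
      rw [← hab', add_mul] at this
      rw [sub_eq_iff_eq_add, this])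
    have h0 := hdisj _ (N.smul_mem (MulOpposite.op ((b : M) : A)) a.2) 
      (h1 ▸ N'.sub_mem b.2 (N'.smul_mem _ b.2))
    rw [h0, sub_eq_zero] at h1
    exact ⟨(congrArg Subtype.val h1).symm, congrArg Subtype.val h0⟩
  rcases he.2.2 _ _ ha.1 hb.1 hb.2 ha.2 hab' with h | h
  · left
    have ha0 : (a : M) = 0 := Subtype.ext h
    rw [ha0, zero_add] at hab
    have := hc.inf_eq_bot
    rwa [top N' (hab ▸ b.2), inf_top_eq] at this
  · right
    have hb0 : (b : M) = 0 := Subtype.ext h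
    rw [hb0, add_zero] at hab
    have := hc.inf_eq_bot
    rwa [top N (hab ▸ a.2), top_inf_eq] at this

/-- An idempotent `e` with `S e ≠ 0` for which `eA` has least dimension is primitive. -/
theorem exists_isPrimitiveIdempotent_smul_ne_zero (S : FinRightMod.{w} F A) [Nontrivial S] :
    ∃ e : A, IsPrimitiveIdempotent e ∧ ∃ s : S, MulOpposite.op e • s ≠ 0 := by
  let dim : A → ℕ := fun e =>
    Module.finrank F ((Submodule.span Aᵐᵒᵖ {e} : Submodule Aᵐᵒᵖ A).restrictScalars F)
  let C : Set A := {e | IsIdempotentElem e ∧ ∃ s : S, MulOpposite.op e • s ≠ 0}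
  have hC : C.Nonempty := by
    obtain ⟨s, hs⟩ := exists_ne (0 : S)
    exact ⟨1, IsIdempotentElem.one, s, by simpa using hs⟩
  obtain ⟨e, heC, hmin⟩ : ∃ e ∈ C, ∀ a ∈ C, dim e ≤ dim a :=
    ⟨Function.argminOn dim C hC, Function.argminOn_mem dim C hC, fun a ha =>
      Function.argminOn_le dim C ha⟩
  obtain ⟨he, s, hs⟩ := heC
  have lt : ∀ a b : A, IsIdempotentElem a → IsIdempotentElem b → a * b = 0 → b * a = 0 →
      a + b = e → b ≠ 0 → dim a < dim e := by
    rintro a b ha hb hab hba rfl hb0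
    refine Submodule.finrank_lt_finrank_of_lt (SetLike.lt_iff_le_and_exists.2
      ⟨fun x hx => ?_, b, ?_, ?_⟩)
    · have hx' : a * x = x := ha.mem_span_op_iff.1 hx
      refine he.mem_span_op_iff.2 ?_
      rw [add_mul, hx', ← hx', ← mul_assoc b, hba, zero_mul, add_zero]
    · refine he.mem_span_op_iff.2 ?_
      rw [add_mul, hab, hb.eq, zero_add]
    · intro h
      have : a * b = b := ha.mem_span_op_iff.1 h
      exact hb0 (by rw [← this, hab])
  refine ⟨e, ⟨?_, he, fun a b ha hb hab hba h => ?_⟩, s, hs⟩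
  · rintro rfl
    simp at hs
  · by_contra! hne
    have h1 := lt a b ha hb hab hba h hne.2
    have h2 := lt b a hb ha hba hab (by rw [add_comm, h]) hne.1
    have : MulOpposite.op a • s ≠ 0 ∨ MulOpposite.op b • s ≠ 0 := by
      by_contra! h0
      apply hs
      rw [← h, MulOpposite.op_add, add_smul, h0.1, h0.2, add_zero]
    rcases this with h0 | h0
    · exact absurd (hmin a ⟨ha, s, h0⟩) (not_le.2 h1)
    · exact absurd (hmin b ⟨hb, s, h0⟩) (not_le.2 h2)

/-- Every simple module is a quotient of `eA` for a primitive idempotent `e`. -/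
theorem exists_primitive_rightIdeal_surjective (S : FinRightMod.{w} F A)
    (hS : IsSimpleModule Aᵐᵒᵖ S) :
    ∃ e : A, IsPrimitiveIdempotent e ∧
      ∃ q : FinRightMod.rightIdeal F e →ₗ[Aᵐᵒᵖ] S, Function.Surjective q := by
  have := IsSimpleModule.nontrivial Aᵐᵒᵖ S
  obtain ⟨e, he, s, hs⟩ := exists_isPrimitiveIdempotent_smul_ne_zero S
  let q : (Submodule.span Aᵐᵒᵖ {e} : Submodule Aᵐᵒᵖ A) →ₗ[Aᵐᵒᵖ] S :=
    { toFun := fun x => MulOpposite.op (x : A) • s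
      map_add' := fun x y => by simp [add_smul]
      map_smul' := fun c x => by
        change MulOpposite.op ((x : A) * c.unop) • s = c • _
        rw [MulOpposite.op_mul, mul_smul]; rfl }
  refine ⟨e, he, q, LinearMap.surjective_of_ne_zero fun h => hs ?_⟩
  exact LinearMap.congr_fun h ⟨e, Submodule.mem_span_singleton_self e⟩

variable (F A) in
/-- The isomorphism relation on simple right `A`-modules. -/
def simpleModuleSetoid : Setoid {M : FinRightMod.{w} F A // IsSimpleModule Aᵐᵒᵖ M} where
  r M N := Nonempty (M.1 ≃ₗ[Aᵐᵒᵖ] N.1)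
  iseqv := ⟨fun _ => ⟨LinearEquiv.refl _ _⟩, fun ⟨e⟩ => ⟨e.symm⟩, fun ⟨e⟩ ⟨e'⟩ => ⟨e.trans e'⟩⟩

variable (F A) in
/-- Every finite-dimensional algebra has a complete system of simple modules, with projective covers
generated by primitive idempotents. -/
theorem exists_isSimplePIMSystem :
    ∃ (ι : Type (max u (w + 1))) (S : ι → FinRightMod.{w} F A) (f : ι → A),
      (∀ i, IsPrimitiveIdempotent (f i)) ∧
      IsSimplePIMSystem S fun i => FinRightMod.rightIdeal F (f i) := by
  let S : Quotient (simpleModuleSetoid F A) → FinRightMod.{w} F A := fun i => i.out.1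
  have hS : ∀ i, IsSimpleModule Aᵐᵒᵖ (S i) := fun i => i.out.2
  choose f hf q hq using fun i => exists_primitive_rightIdeal_surjective (S i) (hS i)
  refine ⟨_, S, f, hf, hS, fun i j hij => ?_, fun M hM => ?_, fun i => ?_, fun i => ?_, fun i => ?_⟩
  · rw [← i.out_eq, ← j.out_eq]
    exact Quotient.sound hij
  · obtain ⟨e⟩ := Quotient.mk_out (s := simpleModuleSetoid F A) ⟨M, hM⟩
    exact ⟨Quotient.mk (simpleModuleSetoid F A) ⟨M, hM⟩, ⟨e.symm⟩⟩
  · exact projective_rightIdeal (hf i).2.1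
  · exact (hf i).isIndecomposableModule
  · have := projective_rightIdeal (F := F) (hf i).2.1
    have := hS i
    exact ⟨(Submodule.quotEquivOfEq _ _
      ((hf i).isIndecomposableModule.jacobson_eq_ker (hq i))).trans
      ((q i).quotKerEquivOfSurjective (hq i))⟩

end Idempotents

/-! ### Lifting idempotents along matrix representations -/

section IdempotentLifting

theorem IsIdempotentElem.units_conj {R : Type*} [Ring R] {D : R} (hD : IsIdempotentElem D) (U : Rˣ) :
    IsIdempotentElem (U * D * ↑U⁻¹) := by
  change (U : R) * D * ↑U⁻¹ * (U * D * ↑U⁻¹) = U * D * ↑U⁻¹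
  calc (U : R) * D * ↑U⁻¹ * (U * D * ↑U⁻¹) = U * D * (↑U⁻¹ * U) * D * ↑U⁻¹ := by
        simp only [mul_assoc]
    _ = U * (D * D) * ↑U⁻¹ := by rw [Units.inv_mul, mul_one]; simp only [mul_assoc]
    _ = U * D * ↑U⁻¹ := by rw [hD.eq]

/-- Let `x` be idempotent modulo `t`, and `D` an idempotent for which `U = x D + (1 - x)(1 - D)` is a
unit. As `x U` and `U D` agree modulo `t`, the idempotent `U D U⁻¹` is congruent to `x` modulo `t`. -/
theorem exists_isIdempotentElem_sub_eq_smul {O R : Type*} [CommRing O] [Ring R] [Algebra O R]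
    {t : O} {x z D : R} (hx : x * x - x = t • z) (hD : IsIdempotentElem D)
    (hU : IsUnit (x * D + (1 - x) * (1 - D))) :
    ∃ e z' : R, IsIdempotentElem e ∧ e - x = t • z' := by
  obtain ⟨U, hU⟩ := hU
  have h1 : (U : R) * D - x * U = t • (z * (1 - 2 * D)) := by
    rw [← smul_mul_assoc, ← hx, hU]
    have h2 : (x * D + (1 - x) * (1 - D)) * D = x * D := by
      rw [add_mul, mul_assoc, mul_assoc, sub_mul 1 D D, hD.eq]
      simp
    rw [h2]
    noncomm_ring
  refine ⟨U * D * ↑U⁻¹, z * (1 - 2 * D) * ↑U⁻¹, hD.units_conj U, ?_⟩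
  · rw [← smul_mul_assoc, ← h1, sub_mul, mul_assoc x, Units.mul_inv, mul_one]

/-- Elements congruent to `1` modulo the maximal ideal are right invertible in a finite algebra over
a local ring. -/
theorem exists_one_add_smul_mul_eq_one {O R : Type*} [CommRing O] [IsLocalRing O] [Ring R]
    [Algebra O R] [Module.Finite O R] {π : O} (hπ : π ∈ IsLocalRing.maximalIdeal O) (y : R) :
    ∃ v, (1 + π • y) * v = 1 := by
  have hs : (⊤ : Submodule O R) ≤ LinearMap.range (LinearMap.mulLeft O (1 + π • y)) := by
    refine Submodule.le_of_le_smul_of_le_jacobson_bot Module.Finite.fg_top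
      (IsLocalRing.maximalIdeal_le_jacobson _) fun x _ => ?_
    have : x = (1 + π • y) * x + π • (- (y * x)) := by
      rw [add_mul, one_mul, smul_mul_assoc]; simp
    rw [this]
    exact Submodule.add_mem_sup ⟨x, rfl⟩ (Submodule.smul_mem_smul hπ trivial)
  exact hs (x := 1) trivial

theorem isUnit_one_add_smul {O R : Type*} [CommRing O] [IsLocalRing O] [Ring R]
    [Algebra O R] [Module.Finite O R] {π : O} (hπ : π ∈ IsLocalRing.maximalIdeal O) (y : R) :
    IsUnit (1 + π • y) := by
  obtain ⟨v, hv⟩ := exists_one_add_smul_mul_eq_one hπ y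
  obtain ⟨v', hv'⟩ := exists_one_add_smul_mul_eq_one (R := Rᵐᵒᵖ) hπ (MulOpposite.op y)
  refine isUnit_iff_exists_and_exists.2 ⟨⟨v, hv⟩, v'.unop, ?_⟩
  have := congrArg MulOpposite.unop hv'
  simpa using this

/-- The iteration `a ↦ 3a² - 2a³` makes an approximate idempotent as good as wanted. -/
theorem exists_mul_self_sub_eq_pow_smul {O R : Type*} [CommRing O] [Ring R] [Algebra O R] {π : O}
    {a z : R} (ha : a * a - a = π • z) (n : ℕ) :
    ∃ b y y' : R, b * b - b = π ^ (n + 1) • y ∧ b - a = π • y' := by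
  induction n with
  | zero => exact ⟨a, z, 0, by simpa using ha, by simp⟩
  | succ n ih =>
    obtain ⟨b, y, y', hb, hba⟩ := ih
    have h1 : (3 * (b * b) - 2 * (b * b * b)) * (3 * (b * b) - 2 * (b * b * b)) -
        (3 * (b * b) - 2 * (b * b * b)) = (b * b - b) * (b * b - b) * (4 * (b * b - b) - 3) := by
      noncomm_ring
    have h2 : (3 * (b * b) - 2 * (b * b * b)) - a = (b * b - b) * (1 - 2 * b) + (b - a) := by
      noncomm_ring
    refine ⟨3 * (b * b) - 2 * (b * b * b), π ^ n • (y * y) * (4 * (b * b - b) - 3),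
      π ^ n • y * (1 - 2 * b) + y', ?_, ?_⟩
    · rw [h1, hb, smul_mul_smul_comm, ← pow_add, smul_mul_assoc, smul_mul_assoc, smul_smul, ← pow_add]
      congr 2
      ring
    · rw [h2, hb, hba, smul_add, smul_mul_assoc, smul_mul_assoc, smul_smul, pow_succ']

/-- An idempotent matrix over a field is diagonalisable with eigenvalues `0` and `1`. -/
theorem IsIdempotentElem.exists_mul_eq_mul_diagonal {k d : Type*} [Field k] [Fintype d]
    [DecidableEq d] {E : Matrix d d k} (hE : IsIdempotentElem E) :
    ∃ (P : Matrix d d k) (c : d → Bool), IsUnit P ∧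
      E * P = P * Matrix.diagonal fun i => if c i then 1 else 0 := by
  let f : (d → k) →ₗ[k] (d → k) := Matrix.toLin' E
  have hf : ∀ x, f (f x) = f x := fun x => by
    simp only [f, Matrix.toLin'_apply, Matrix.mulVec_mulVec, hE.eq]
  have hc : IsCompl (LinearMap.range f) (LinearMap.ker f) := by
    refine ⟨Submodule.disjoint_def.2 ?_, codisjoint_iff.2 (eq_top_iff.2 fun x _ => ?_)⟩
    · rintro _ ⟨x, rfl⟩ h
      rw [LinearMap.mem_ker, hf] at h
      exact h
    · rw [← add_sub_cancel (f x) x]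
      exact Submodule.add_mem_sup ⟨x, rfl⟩ (by simp [hf])
  let b0 := ((Module.finBasis k (LinearMap.range f)).prod (Module.finBasis k (LinearMap.ker f))).map
    (Submodule.prodEquivOfIsCompl _ _ hc)
  have hcard : Fintype.card (Fin (Module.finrank k (LinearMap.range f)) ⊕
      Fin (Module.finrank k (LinearMap.ker f))) = Fintype.card d := by
    rw [← Module.finrank_eq_card_basis b0, Module.finrank_fintype_fun_eq_card]
  let σ := Fintype.equivOfCardEq hcard
  let b : Module.Basis d k (d → k) := b0.reindex σ
  have hb0 : ∀ j, f (b0 j) = (if j.isLeft then (1 : k) else 0) • b0 j := by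
    rintro (j | j)
    · obtain ⟨x, hx⟩ := (Module.finBasis k (LinearMap.range f) j).2
      simp [b0, ← hx, hf]
    · simp [b0]
  refine ⟨(Pi.basisFun k d).toMatrix b, fun i => (σ.symm i).isLeft, ?_, ?_⟩
  · exact IsUnit.of_mul_eq_one _ ((Pi.basisFun k d).toMatrix_mul_toMatrix_flip b)
  · ext i j
    have := congrFun (hb0 (σ.symm j)) i
    rw [Matrix.mul_diagonal, Matrix.mul_apply]
    simp only [f, Matrix.toLin'_apply, Matrix.mulVec, dotProduct, Pi.smul_apply, smul_eq_mul] at this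
    rw [mul_comm] at this
    simpa [Module.Basis.toMatrix_apply, b] using this

/-- Idempotent matrices lift along a surjective local homomorphism to a field: after
diagonalisation, lift the base change matrix. -/
theorem exists_isIdempotentElem_map_eq {O k d : Type*} [CommRing O] [Field k] [Fintype d]
    [DecidableEq d] (r : O →+* k) [IsLocalHom r] (hr : Function.Surjective r)
    {E : Matrix d d k} (hE : IsIdempotentElem E) :
    ∃ D : Matrix d d O, IsIdempotentElem D ∧ D.map r = E := by
  obtain ⟨P, c, hP, hEP⟩ := hE.exists_mul_eq_mul_diagonal
  choose s hs using hr
  let P' : Matrix d d O := P.map s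
  have hP' : P'.map r = P := by ext; simp [P', hs]
  have hu : IsUnit P' := by
    rw [Matrix.isUnit_iff_isUnit_det] at hP ⊢
    refine isUnit_of_map_unit r _ ?_
    rwa [RingHom.map_det, RingHom.mapMatrix_apply, hP']
  obtain ⟨U, hU⟩ := hu
  let Δ : Matrix d d O := Matrix.diagonal fun i => if c i then 1 else 0
  have hΔ : Δ * Δ = Δ := by
    simp only [Δ, Matrix.diagonal_mul_diagonal, mul_ite, mul_one, mul_zero]
    congr 1
    ext i
    cases c i <;> simp
  have hΔr : Δ.map r = Matrix.diagonal fun i => if c i then 1 else 0 := by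
    rw [Matrix.diagonal_map (map_zero r)]
    congr 1
    ext i
    cases c i <;> simp
  refine ⟨U * Δ * (U⁻¹ : (Matrix d d O)ˣ), IsIdempotentElem.units_conj hΔ U, ?_⟩
  · refine hP.mul_right_cancel ?_
    rw [hEP, ← hP', ← hU, ← hΔr, ← Matrix.map_mul, ← Matrix.map_mul, mul_assoc, Units.inv_mul,
      mul_one]

/-- Let `Λ` be a finite algebra over a local ring `O` that maps, with nil kernel, to a product of
matrix algebras over `O` in such a way that the image contains all multiples of `s`. If `s` divides
a power of `π`, then idempotents lift modulo `π`. -/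
theorem exists_isIdempotentElem_of_matrix_rep {O k Λ : Type*} [CommRing O] [IsLocalRing O] [Field k]
    [Ring Λ] [Algebra O Λ] [Module.Finite O Λ] (r : O →+* k) [IsLocalHom r]
    (hr : Function.Surjective r) {π s : O} (hπ : RingHom.ker r = Ideal.span {π}) {m : ℕ}
    (hs : s ∣ π ^ m) {n : ℕ} {d : Fin n → ℕ}
    (θ : Λ →ₐ[O] Π i, Matrix (Fin (d i)) (Fin (d i)) O) (hker : ∀ x, θ x = 0 → IsNilpotent x)
    (hsurj : ∀ γ, ∃ x, θ x = s • γ) {a z : Λ} (ha : a * a - a = π • z) :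
    ∃ e z' : Λ, IsIdempotentElem e ∧ e - a = π • z' := by
  have hπm : π ∈ IsLocalRing.maximalIdeal O := by
    rw [IsLocalRing.mem_maximalIdeal]
    intro h
    have : r π = 0 := by
      rw [← RingHom.mem_ker, hπ]; exact Ideal.mem_span_singleton_self π
    exact (h.map r).ne_zero this
  -- the precision `m + 1` leaves one factor `π` after division by `s`
  obtain ⟨b, y, y', hb, hba⟩ := exists_mul_self_sub_eq_pow_smul ha m
  -- an idempotent of the product of matrix algebras that is congruent to `θ b` modulo `π`
  obtain ⟨D, w, hD, hDb⟩ : ∃ D w : Π i, Matrix (Fin (d i)) (Fin (d i)) O,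
      IsIdempotentElem D ∧ D - θ b = π • w := by
    have hi : ∀ i, ∃ D w : Matrix (Fin (d i)) (Fin (d i)) O,
        IsIdempotentElem D ∧ D - θ b i = π • w := fun i => by
      have hrπ : r π = 0 := by
        rw [← RingHom.mem_ker, hπ]; exact Ideal.mem_span_singleton_self π
      have hE : IsIdempotentElem ((θ b i).map r) := by
        have h1 : θ b * θ b - θ b = π ^ (m + 1) • θ y := by
          rw [← map_mul, ← map_sub, hb, map_smul]
        have h2 := congrArg (r.mapMatrix (m := Fin (d i))) (congrFun h1 i)
        simp only [Pi.sub_apply, Pi.mul_apply, map_sub, map_mul] at h2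
        refine sub_eq_zero.1 (h2.trans ?_)
        ext p q
        simp [hrπ]
      obtain ⟨D, hD, hDr⟩ := exists_isIdempotentElem_map_eq r hr hE
      have hdvd : ∀ p q, ∃ c, (D - θ b i) p q = π * c := fun p q => by
        have : (D - θ b i) p q ∈ RingHom.ker r := by
          rw [RingHom.mem_ker, Matrix.sub_apply, map_sub, sub_eq_zero]
          exact congrFun (congrFun hDr p) q
        rw [hπ] at this
        exact Ideal.mem_span_singleton.1 this
      choose c hc using hdvd
      exact ⟨D, Matrix.of c, hD, by ext p q; simpa using hc p q⟩
    choose D w hD hw using hi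
    exact ⟨D, w, funext hD, funext hw⟩
  obtain ⟨e', z', he', hez'⟩ := exists_isIdempotentElem_sub_eq_smul (t := π ^ (m + 1)) (x := θ b)
    (z := θ y) (by rw [← map_mul, ← map_sub, hb, map_smul]) hD (by
      convert isUnit_one_add_smul hπm (π ^ m • (2 * θ y) + (2 * θ b - 1) * w) using 1
      have h1 : θ b * θ b - θ b = π ^ (m + 1) • θ y := by
        rw [← map_mul, ← map_sub, hb, map_smul]
      rw [smul_add, smul_smul, ← pow_succ', ← mul_smul_comm, ← mul_smul_comm, ← h1, ← hDb]
      noncomm_ring)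
  -- this idempotent lies in the image of `θ`, so it lifts along the nil kernel
  obtain ⟨c, hc⟩ := hs
  obtain ⟨l, hl⟩ := hsurj (c • z')
  have hel : θ (b + π • l) = e' := by
    rw [map_add, map_smul, hl, smul_smul, smul_smul, mul_assoc, ← hc, ← pow_succ', ← hez']
    abel
  obtain ⟨e, he, hθe⟩ := exists_isIdempotentElem_eq_of_ker_isNilpotent
    (θ : Λ →+* Π i, Matrix (Fin (d i)) (Fin (d i)) O)
    (fun x hx => hker x hx) e' ⟨b + π • l, hel⟩ he'
  have hθe' : θ e = e' := hθe
  -- `e` agrees with `a` modulo `π` only up to `ν`, which lies in the nil kernel: conjugate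
  refine exists_isIdempotentElem_sub_eq_smul ha he ?_
  obtain ⟨ν, hν⟩ : ∃ ν, e = b + π • l + ν := ⟨e - (b + π • l), by abel⟩
  have hθν : θ ν = 0 := by
    have := hθe'
    rw [hν, map_add, hel] at this
    simpa using this
  have hu : IsUnit (1 + (2 * a - 1) * ν) :=
    (hker _ (by rw [map_mul, hθν, mul_zero])).isUnit_one_add
  obtain ⟨V, hV⟩ := hu
  convert V.isUnit.mul (isUnit_one_add_smul hπm (↑V⁻¹ * (2 * z + (2 * a - 1) * (y' + l)))) using 1
  rw [mul_add, mul_one, mul_smul_comm, Units.mul_inv_cancel_left, hV, hν, ← sub_add_cancel b a,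
    hba, smul_add, ← mul_smul_comm π 2, ← ha, ← mul_smul_comm π (2 * a - 1), smul_add]
  generalize π • y' = Y
  generalize π • l = L
  noncomm_ring

end IdempotentLifting

/-! ### Split algebras and integral matrix representations -/

section MatrixRepresentation

variable {O K Λ : Type*} [CommRing O] [IsDomain O] [IsPrincipalIdealRing O] [Field K] [Algebra O K]
  [IsFractionRing O K] [Ring Λ] [Algebra O Λ] [Module.Finite O Λ]

/-- A matrix representation over `K` of a finite algebra over a principal ideal domain is equivalent
to an integral one, because it stabilises the lattice generated by the standard basis. -/
theorem exists_integral_matrix_rep {d : Type*} [Fintype d] [DecidableEq d]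
    (φ : Λ →ₐ[O] Matrix d d K) :
    ∃ (α : Matrix d d K ≃ₐ[K] Matrix d d K) (θ : Λ →ₐ[O] Matrix d d O),
      ∀ x, (θ x).map (algebraMap O K) = α (φ x) := by
  let ev : d → Λ →ₗ[O] (d → K) := fun j =>
    { toFun := fun x => (φ x).mulVec (Pi.single j 1)
      map_add' := fun x y => by rw [map_add, Matrix.add_mulVec]
      map_smul' := fun c x => by rw [map_smul, Matrix.smul_mulVec]; rfl }
  let L : Submodule O (d → K) := ⨆ j, LinearMap.range (ev j)
  have hmem : ∀ j, (Pi.single j 1 : d → K) ∈ L := fun j =>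
    Submodule.mem_iSup_of_mem j ⟨1, by
      simp only [ev, LinearMap.coe_mk, AddHom.coe_mk, map_one, Matrix.one_mulVec]⟩
  have hstab : ∀ x, ∀ v ∈ L, (φ x).mulVec v ∈ L := fun x v hv => by
    induction hv using Submodule.iSup_induction' with
    | mem j v hv =>
      obtain ⟨y, rfl⟩ := hv
      exact Submodule.mem_iSup_of_mem j ⟨x * y, by
        simp only [ev, LinearMap.coe_mk, AddHom.coe_mk, map_mul, Matrix.mulVec_mulVec]⟩
    | zero => simp
    | add v w _ _ hv hw => rw [Matrix.mulVec_add]; exact L.add_mem hv hw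
  have hL : L.IsLattice K := by
    refine ⟨Submodule.fg_iSup _ fun j => ?_, eq_top_iff.2 ?_⟩
    · rw [LinearMap.range_eq_map]
      exact Module.Finite.fg_top.map _
    · rw [← (Pi.basisFun K d).span_eq, Submodule.span_le]
      rintro _ ⟨j, rfl⟩
      rw [Pi.basisFun_apply]
      exact Submodule.subset_span (hmem j)
  have : Module.Free O L := Submodule.IsLattice.free K L
  let b0 := Module.Free.chooseBasis O L
  have hcard : Fintype.card (Module.Free.ChooseBasisIndex O L) = Fintype.card d := by
    rw [← Module.finrank_eq_card_basis (b0.extendOfIsLattice K), Module.finrank_fintype_fun_eq_card]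
  let σ := Fintype.equivOfCardEq hcard
  let b : Module.Basis d K (d → K) := (b0.extendOfIsLattice K).reindex σ
  have hbL : Submodule.span O (Set.range b) = L := by
    have : (b : d → d → K) = L.subtype ∘ b0 ∘ σ.symm := by ext; simp [b]
    rw [this, Set.range_comp, ← Submodule.map_span, EquivLike.range_comp, b0.span_eq,
      Submodule.map_subtype_top]
  let α : Matrix d d K ≃ₐ[K] Matrix d d K :=
    Matrix.toLinAlgEquiv'.trans (LinearMap.toMatrixAlgEquiv b)
  let j : Matrix d d O →ₐ[O] Matrix d d K := (Algebra.ofId O K).mapMatrix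
  have hj : Function.Injective j := fun M N h => by
    ext p q
    exact IsFractionRing.injective O K (congrFun (congrFun h p) q)
  let ψ : Λ →ₐ[O] Matrix d d K := ((α.toAlgHom.restrictScalars O).comp φ)
  have hψ : ∀ x, ψ x ∈ j.range := fun x => by
    have : ∀ p q, ∃ c : O, algebraMap O K c = ψ x p q := fun p q => by
      have h1 : ψ x p q = b.repr ((φ x).mulVec (b q)) p := by
        change LinearMap.toMatrixAlgEquiv b _ p q = _
        rw [LinearMap.toMatrixAlgEquiv_apply]
        rfl
      have h2 : (φ x).mulVec (b q) ∈ Submodule.span O (Set.range b) := by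
        rw [hbL]
        refine hstab x _ ?_
        rw [← hbL]
        exact Submodule.subset_span ⟨q, rfl⟩
      obtain ⟨c, hc⟩ := (b.mem_span_iff_repr_mem O _).1 h2 p
      exact ⟨c, by rw [h1, hc]⟩
    choose c hc using this
    exact ⟨Matrix.of c, by ext p q; exact hc p q⟩
  let θ := (AlgEquiv.ofInjective j hj).symm.toAlgHom.comp (ψ.codRestrict j.range hψ)
  refine ⟨α, θ, fun x => ?_⟩
  exact congrArg Subtype.val
    ((AlgEquiv.ofInjective j hj).apply_symm_apply (ψ.codRestrict j.range hψ x))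

end MatrixRepresentation

section Wedderburn

/-- A finite-dimensional algebra for which all endomorphisms of simple modules are scalars maps
onto a product of matrix algebras over the ground field, with nil kernel. -/
theorem exists_pi_matrix_of_split {K : Type u} {C : Type w} [Field K] [Ring C] [Algebra K C]
    [Module.Finite K C]
    (hC : ∀ (S : Type w) [AddCommGroup S] [Module K S] [Module C S] [IsScalarTower K C S]
      [Module.Finite K S], IsSimpleModule C S →
      ∀ φ : S →ₗ[C] S, ∃ c : K, ∀ x : S, φ x = c • x) :
    ∃ (n : ℕ) (d : Fin n → ℕ) (ρ : C →ₐ[K] Π i, Matrix (Fin (d i)) (Fin (d i)) K),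
      Function.Surjective ρ ∧ ∀ x, ρ x = 0 → IsNilpotent x := by
  have : IsArtinianRing C := isArtinian_of_tower K inferInstance
  let J := Ring.jacobson C
  obtain ⟨n, S, d, hS, -, ⟨e⟩⟩ :=
    IsSemisimpleRing.exists_algEquiv_pi_matrix_end_mulOpposite K (C ⧸ J)
  have hend : ∀ i, ∀ φ : Module.End (C ⧸ J) (S i), ∃ c : K, φ = algebraMap K _ c := fun i φ => by
    let _ : Module C (S i) := Module.compHom _ (Ideal.Quotient.mk J)
    have hs : ∀ (c : C) (x : S i), c • x = Ideal.Quotient.mk J c • x := fun _ _ => rfl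
    have hT : IsScalarTower K C (S i) := ⟨fun c a x => by
      rw [hs, hs]
      have : Ideal.Quotient.mk J (c • a) = c • Ideal.Quotient.mk J a := rfl
      rw [this, smul_assoc]⟩
    have : Module.Finite K (C ⧸ J) := Module.Finite.of_surjective
      (Ideal.Quotient.mkₐ K J).toLinearMap Ideal.Quotient.mk_surjective
    have : Module.Finite K (S i) := inferInstanceAs (Module.Finite K ((S i).restrictScalars K))
    have hsimple : IsSimpleModule C (S i) := by
      let l : S i →ₛₗ[Ideal.Quotient.mk J] S i :=
        { toFun := id, map_add' := fun _ _ => rfl, map_smul' := fun _ _ => rfl }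
      have : RingHomSurjective (Ideal.Quotient.mk J) := ⟨Ideal.Quotient.mk_surjective⟩
      exact (LinearMap.isSimpleModule_iff_of_bijective l Function.bijective_id).2 (hS i)
    obtain ⟨c, hc⟩ := @hC (S i) _ _ _ hT _ hsimple
      { toFun := φ, map_add' := φ.map_add,
        map_smul' := fun a x => φ.map_smul (Ideal.Quotient.mk J a) x }
    exact ⟨c, LinearMap.ext hc⟩
  have hbij : ∀ i, Function.Bijective (Algebra.ofId K (Module.End (C ⧸ J) (S i))ᵐᵒᵖ) := fun i => by
    have : Nontrivial (S i) := IsSimpleModule.nontrivial (C ⧸ J) (S i)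
    refine ⟨(algebraMap K (Module.End (C ⧸ J) (S i))ᵐᵒᵖ).injective, fun φ => ?_⟩
    obtain ⟨c, hc⟩ := hend i φ.unop
    exact ⟨c, MulOpposite.unop_injective hc.symm⟩
  let e' : (C ⧸ J) ≃ₐ[K] Π i, Matrix (Fin (d i)) (Fin (d i)) K :=
    e.trans (AlgEquiv.piCongrRight fun i => (AlgEquiv.ofBijective _ (hbij i)).symm.mapMatrix)
  refine ⟨n, d, e'.toAlgHom.comp (Ideal.Quotient.mkₐ K J),
    e'.surjective.comp Ideal.Quotient.mk_surjective, fun x hx => ?_⟩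
  have hx' : x ∈ J := by
    rw [← Ideal.Quotient.eq_zero_iff_mem]
    exact e'.injective (hx.trans (map_zero e').symm)
  obtain ⟨m, hm⟩ := IsSemiprimaryRing.isNilpotent (R := C)
  refine ⟨m, ?_⟩
  have : x ^ m ∈ J ^ m := Ideal.pow_mem_pow hx' m
  rw [hm] at this
  exact this

end Wedderburn

/-! ### Lifting idempotents without completeness -/

section Heller

/-- Idempotents of `Λ / πΛ` lift to `Λ`, for a finite algebra `Λ` over a discrete valuation ring that
spans a split algebra `C` over the field of fractions. -/
theorem exists_isIdempotentElem_of_split_rep {O K k Λ C : Type*} [CommRing O] [IsDomain O]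
    [IsDiscreteValuationRing O] [Field K] [Algebra O K] [IsFractionRing O K] [Field k] [Ring Λ]
    [Algebra O Λ] [Module.Finite O Λ] [Ring C] [Algebra K C] [Algebra O C] [IsScalarTower O K C]
    (r : O →+* k) (hr : Function.Surjective r) {π : O} (hπ : Irreducible π)
    (hrπ : RingHom.ker r = Ideal.span {π})
    (j : Λ →ₐ[O] C) (hj : Function.Injective j) (hjs : ∀ c : C, ∃ s : O, s ≠ 0 ∧ ∃ x, j x = s • c)
    {n : ℕ} {d : Fin n → ℕ} (ρ : C →ₐ[K] Π i, Matrix (Fin (d i)) (Fin (d i)) K)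
    (hρ : Function.Surjective ρ) (hker : ∀ x, ρ x = 0 → IsNilpotent x)
    {a z : Λ} (ha : a * a - a = π • z) :
    ∃ e z' : Λ, IsIdempotentElem e ∧ e - a = π • z' := by
  have hlocal : IsLocalHom r := by
    refine ⟨fun x hx => ?_⟩
    by_contra h
    have hm : RingHom.ker r = IsLocalRing.maximalIdeal O := by
      rw [hrπ, hπ.maximalIdeal_eq]
    have : x ∈ RingHom.ker r := by rw [hm]; exact h
    exact hx.ne_zero this
  choose α θ hθ using fun i => exists_integral_matrix_rep (O := O)
    (((Pi.evalAlgHom K (fun i => Matrix (Fin (d i)) (Fin (d i)) K) i).comp ρ).restrictScalars O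
      |>.comp j)
  have hθ' : ∀ i x, (θ i x).map (algebraMap O K) = α i (ρ (j x) i) := hθ
  have hinj : ∀ {d : ℕ} {M N : Matrix (Fin d) (Fin d) O},
      M.map (algebraMap O K) = N.map (algebraMap O K) → M = N := fun {d M N} h => by
    ext p q
    exact IsFractionRing.injective O K (congrFun (congrFun h p) q)
  let Θ : Λ →ₐ[O] Π i, Matrix (Fin (d i)) (Fin (d i)) O := AlgHom.pi θ
  have hΘker : ∀ x, Θ x = 0 → IsNilpotent x := fun x hx => by
    have h0 : ρ (j x) = 0 := by
      ext1 i
      apply (α i).injective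
      rw [← hθ', show θ i x = 0 from congrFun hx i, Pi.zero_apply, map_zero]
      ext; simp
    obtain ⟨m, hm⟩ := hker _ h0
    exact ⟨m, hj (by rw [map_pow, hm, map_zero])⟩
  have hΘs : ∀ γ, ∃ s : O, s ≠ 0 ∧ ∃ x, Θ x = s • γ := fun γ => by
    obtain ⟨c, hc⟩ := hρ fun i => (α i).symm ((γ i).map (algebraMap O K))
    obtain ⟨s, hs, x, hx⟩ := hjs c
    refine ⟨s, hs, x, funext fun i => hinj ?_⟩
    change (θ i x).map _ = _
    have h1 : ρ (j x) i = algebraMap O K s • ρ c i := by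
      rw [hx, ← algebraMap_smul K s c, map_smul]; rfl
    rw [hθ', h1, hc, map_smul, AlgEquiv.apply_symm_apply]
    ext p q
    simp
  -- a common denominator, as the cokernel of `Θ` is a finite torsion module
  obtain ⟨s, hs0, hs⟩ : ∃ s : O, s ≠ 0 ∧ ∀ γ, ∃ x, Θ x = s • γ := by
    let N := LinearMap.range Θ.toLinearMap
    have ht : Module.IsTorsion O ((Π i, Matrix (Fin (d i)) (Fin (d i)) O) ⧸ N) := by
      rintro ⟨γ⟩
      obtain ⟨s, hs, x, hx⟩ := hΘs γ
      exact ⟨⟨s, mem_nonZeroDivisors_of_ne_zero hs⟩,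
        (Submodule.Quotient.mk_eq_zero N).2 ⟨x, hx⟩⟩
    obtain ⟨s, hs, hs'⟩ := Submodule.annihilator_top_inter_nonZeroDivisors ht
    refine ⟨s, nonZeroDivisors.ne_zero hs', fun γ => ?_⟩
    have := Submodule.mem_annihilator.1 hs (N.mkQ γ) trivial
    rw [← map_smul, Submodule.mkQ_apply, Submodule.Quotient.mk_eq_zero] at this
    exact this
  obtain ⟨m, u, rfl⟩ := IsDiscreteValuationRing.eq_unit_mul_pow_irreducible hs0 hπ
  exact exists_isIdempotentElem_of_matrix_rep r hr hrπ (m := m)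
    ((Units.isUnit u).mul_left_dvd.2 dvd_rfl) Θ hΘker hs ha

/-- Idempotents of `Λ / πΛ` lift to `Λ`, for a finite algebra `Λ` over a discrete valuation ring
whose scalar extension `A` to the field of fractions `K` is split by `K`. -/
theorem exists_isIdempotentElem_of_isSplittingFieldFor {O Λ k : Type*} {K : Type u} {A : Type w}
    [CommRing O] [IsDomain O] [IsDiscreteValuationRing O] [Field K] [Algebra O K]
    [IsFractionRing O K] [Field k] [Ring Λ] [Algebra O Λ] [Module.Finite O Λ] [Ring A] [Algebra K A]
    [Module.Finite K A] [Algebra O A] [IsScalarTower O K A]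
    (r : O →+* k) (hr : Function.Surjective r) {π : O} (hπ : Irreducible π)
    (hrπ : RingHom.ker r = Ideal.span {π}) (hK : IsSplittingFieldFor.{w} K A)
    (j : Λ →ₐ[O] A) (hj : Function.Injective j) (hjs : ∀ c : A, ∃ s : O, s ≠ 0 ∧ ∃ x, j x = s • c)
    {a z : Λ} (ha : a * a - a = π • z) :
    ∃ e z' : Λ, IsIdempotentElem e ∧ e - a = π • z' := by
  have : Module.Finite K Aᵐᵒᵖ := Module.Finite.equiv (MulOpposite.opLinearEquiv K : A ≃ₗ[K] _)
  have : Module.Finite O Λᵐᵒᵖ := Module.Finite.equiv (MulOpposite.opLinearEquiv O : Λ ≃ₗ[O] _)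
  obtain ⟨n, d, ρ, hρ, hρker⟩ := exists_pi_matrix_of_split (K := K) (C := Aᵐᵒᵖ)
    fun S _ _ _ _ _ hS => hK ⟨S⟩ hS
  obtain ⟨e, z', he, hez⟩ := exists_isIdempotentElem_of_split_rep r hr hπ hrπ (AlgHom.op j)
    (MulOpposite.op_injective.comp (hj.comp MulOpposite.unop_injective))
    (fun c => by
      obtain ⟨s, hs, x, hx⟩ := hjs c.unop
      exact ⟨s, hs, MulOpposite.op x, congrArg MulOpposite.op hx⟩)
    ρ hρ hρker (a := MulOpposite.op a) (z := MulOpposite.op z) (congrArg MulOpposite.op ha)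
  exact ⟨e.unop, z'.unop, congrArg MulOpposite.unop he, congrArg MulOpposite.unop hez⟩

end Heller

section ScalarExtension

variable {R R' S H : Type*} [CommRing R] [CommRing R'] [CommRing S]
  [Ring H] [Algebra R R'] [Algebra R S] [Algebra R' S] [IsScalarTower R R' S] [Algebra R H]

variable (R R' S H) in
/-- `scalarExtensionMap` as a homomorphism of `R'`-algebras. -/
noncomputable def scalarExtensionAlgHom : R' ⊗[R] H →ₐ[R'] S ⊗[R] H :=
  Algebra.TensorProduct.map (Algebra.ofId R' S) (AlgHom.id R H)

theorem scalarExtensionAlgHom_apply (x : R' ⊗[R] H) :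
    scalarExtensionAlgHom R R' S H x = scalarExtensionMap R R' S H x := rfl

theorem scalarExtensionMap_surjective (h : Function.Surjective (algebraMap R' S)) :
    Function.Surjective (scalarExtensionMap R R' S H) :=
  LinearMap.rTensor_surjective H (g := (IsScalarTower.toAlgHom R R' S).toLinearMap) h

theorem scalarExtensionAlgHom_injective [Module.Flat R H]
    (h : Function.Injective (algebraMap R' S)) :
    Function.Injective (scalarExtensionAlgHom R R' S H) :=
  Module.Flat.rTensor_preserves_injective_linearMap (M := H)
    (IsScalarTower.toAlgHom R R' S).toLinearMap h

/-- The kernel of reduction modulo `π`, by right exactness of the tensor product. -/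
theorem exists_eq_smul_of_scalarExtensionMap_eq_zero (h : Function.Surjective (algebraMap R' S))
    {π : R'} (hπ : RingHom.ker (algebraMap R' S) = Ideal.span {π}) {x : R' ⊗[R] H}
    (hx : scalarExtensionMap R R' S H x = 0) : ∃ z, x = π • z := by
  let f : R' →ₗ[R] R' := LinearMap.mulLeft R π
  let g : R' →ₗ[R] S := (IsScalarTower.toAlgHom R R' S).toLinearMap
  have hfg : Function.Exact f g := fun y => by
    change algebraMap R' S y = 0 ↔ _
    rw [← RingHom.mem_ker, hπ, Ideal.mem_span_singleton']
    constructor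
    · rintro ⟨a, rfl⟩
      exact ⟨a, mul_comm _ _⟩
    · rintro ⟨a, rfl⟩
      exact ⟨a, mul_comm _ _⟩
  obtain ⟨z, hz⟩ := (rTensor_exact H hfg h x).1 hx
  refine ⟨z, ?_⟩
  rw [← hz]
  clear hz
  induction z with
  | zero => simp
  | tmul a b => rfl
  | add a b ha hb => rw [map_add, ha, hb, smul_add]

/-- Elements of `S ⊗ H` have denominators in `R'` when `S` is its field of fractions. -/
theorem exists_scalarExtensionMap_eq_smul [IsDomain R'] [IsFractionRing R' S] (c : S ⊗[R] H) :
    ∃ s : R', s ≠ 0 ∧ ∃ x, scalarExtensionMap R R' S H x = s • c := by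
  induction c with
  | zero => exact ⟨1, one_ne_zero, 0, by simp⟩
  | tmul a b =>
    obtain ⟨⟨x, s⟩, hs⟩ := IsLocalization.surj (nonZeroDivisors R') a
    refine ⟨s, nonZeroDivisors.ne_zero s.2, x ⊗ₜ b, ?_⟩
    rw [TensorProduct.smul_tmul', Algebra.smul_def, mul_comm, hs]
    rfl
  | add a b ha hb =>
    obtain ⟨s, hs, x, hx⟩ := ha
    obtain ⟨t, ht, y, hy⟩ := hb
    refine ⟨s * t, mul_ne_zero hs ht, t • x + s • y, ?_⟩
    rw [← scalarExtensionAlgHom_apply] at hx hy ⊢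
    rw [map_add, map_smul, map_smul, hx, hy, smul_add, smul_smul, smul_smul, mul_comm t s]

end ScalarExtension

section IdempotentLift

variable {R R' K k : Type u} {H : Type v}
  [CommRing R] [CommRing R'] [Field K] [Field k] [Ring H]
  [Algebra R R'] [Algebra R K] [Algebra R k] [Algebra R' K] [Algebra R' k]
  [IsScalarTower R R' K] [IsScalarTower R R' k] [Algebra R H]

/-- If `K` is a splitting field for `KH`, then idempotents of `kH` lift to `R'H`, although `R'` need
not be complete. -/
theorem exists_isIdempotentElem_scalarExtensionMap_eq [Module.Finite R H] [Module.Flat R H]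
    [IsDomain R'] [IsDiscreteValuationRing R'] [IsFractionRing R' K]
    (hk : Function.Surjective (algebraMap R' k))
    (hK : IsSplittingFieldFor.{max u v} K (K ⊗[R] H)) {f : k ⊗[R] H} (hf : IsIdempotentElem f) :
    ∃ g : R' ⊗[R] H, IsIdempotentElem g ∧ scalarExtensionMap R R' k H g = f := by
  obtain ⟨π, hπ⟩ := IsDiscreteValuationRing.exists_irreducible R'
  have hker : RingHom.ker (algebraMap R' k) = Ideal.span {π} := by
    have : (RingHom.ker (algebraMap R' k)).IsMaximal := RingHom.ker_isMaximal_of_surjective _ hk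
    rw [IsLocalRing.eq_maximalIdeal this, hπ.maximalIdeal_eq]
  obtain ⟨a, ha⟩ := scalarExtensionMap_surjective (R := R) (H := H) hk f
  obtain ⟨z, hz⟩ := exists_eq_smul_of_scalarExtensionMap_eq_zero (x := a * a - a) hk hker
    (by rw [map_sub, map_mul, ha, hf.eq, sub_self])
  have hj : Function.Injective (scalarExtensionAlgHom R R' K H) :=
    scalarExtensionAlgHom_injective (IsFractionRing.injective R' K)
  obtain ⟨e, z', he, hez⟩ := exists_isIdempotentElem_of_isSplittingFieldFor (algebraMap R' k) hk hπ
    hker hK (scalarExtensionAlgHom R R' K H) hj exists_scalarExtensionMap_eq_smul hz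
  refine ⟨e, he, ?_⟩
  have h2 : algebraMap R' k π = 0 := by
    rw [← RingHom.mem_ker, hker]
    exact Ideal.mem_span_singleton_self π
  rw [sub_eq_iff_eq_add'.1 hez, map_add, ha, ← scalarExtensionAlgHom_apply, map_smul,
    ← algebraMap_smul k π, h2, zero_smul, add_zero]

end IdempotentLift

/-! ### Lattices and base change -/

section Rank

/-- The rank of an idempotent endomorphism is invariant under base change. -/
theorem finrank_range_baseChange {O S L : Type*} [CommRing O] [IsDomain O] [IsPrincipalIdealRing O]
    [Field S] [Algebra O S] [AddCommGroup L] [Module O L] [Module.Free O L] [Module.Finite O L]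
    {p : L →ₗ[O] L} (hp : p ∘ₗ p = p) :
    Module.finrank S (LinearMap.range (p.baseChange S)) = Module.finrank O (LinearMap.range p) := by
  let i : LinearMap.range p →ₗ[O] L := (LinearMap.range p).subtype
  let q : L →ₗ[O] LinearMap.range p := p.rangeRestrict
  have hqi : q ∘ₗ i = LinearMap.id := by
    ext ⟨_, x, rfl⟩
    exact LinearMap.congr_fun hp x
  have hiq : p = i ∘ₗ q := rfl
  have hqiS : (q.baseChange S) ∘ₗ (i.baseChange S) = LinearMap.id := by
    rw [← LinearMap.baseChange_comp, hqi, LinearMap.baseChange_id]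
  have hinj : Function.Injective (i.baseChange S) :=
    Function.LeftInverse.injective (g := q.baseChange S) (LinearMap.congr_fun hqiS)
  have hsurj : Function.Surjective (q.baseChange S) :=
    Function.RightInverse.surjective (g := i.baseChange S) (LinearMap.congr_fun hqiS)
  have hr : LinearMap.range (p.baseChange S) = LinearMap.range (i.baseChange S) := by
    conv_lhs => rw [hiq, LinearMap.baseChange_comp]
    exact LinearMap.range_comp_of_range_eq_top _ (LinearMap.range_eq_top.2 hsurj)
  rw [hr, LinearMap.finrank_range_of_inj hinj, Module.finrank_baseChange]

end Rank

section Lattice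

variable {R R' K : Type u} {H : Type v} [CommRing R] [CommRing R'] [Field K] [Ring H]
  [Algebra R R'] [Algebra R K] [Algebra R' K] [IsScalarTower R R' K] [Algebra R H]

/-- On a base change `K ⊗ L`, the image of `g ∈ R'H` acts as the base change of the action of `g`. -/
theorem baseChangeAction_scalarExtensionMap (L : FinRightMod.{w} R' (R' ⊗[R] H)) (g : R' ⊗[R] H) :
    baseChangeAction K L (MulOpposite.op (scalarExtensionMap R R' K H g)) =
      (Algebra.lsmul R' R' L (MulOpposite.op g)).baseChange K := by
  refine TensorProduct.AlgebraTensorModule.ext fun t l => ?_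
  change _ = t ⊗ₜ[R'] (MulOpposite.op g • l)
  induction g with
  | zero =>
    rw [map_zero, MulOpposite.op_zero, MulOpposite.op_zero, zero_smul, map_zero,
      TensorProduct.tmul_zero, LinearMap.zero_apply]
  | tmul r h =>
    have h1 : (r ⊗ₜ[R] h : R' ⊗[R] H) = r • ((1 : R') ⊗ₜ[R] h) := by
      rw [TensorProduct.smul_tmul', smul_eq_mul, mul_one]
    refine (baseChangeAction_tmul K L (algebraMap R' K r) t h l).trans ?_
    rw [h1, MulOpposite.op_smul, smul_assoc, ← Algebra.smul_def, TensorProduct.smul_tmul]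
  | add a b ha hb =>
    rw [map_add, MulOpposite.op_add, MulOpposite.op_add, add_smul, map_add, LinearMap.add_apply,
      ha, hb, TensorProduct.tmul_add]

/-- `dim Hom(g KH, K ⊗ L)` is the rank of `L g`. In particular it is the same for all fields over
`R'`. -/
theorem homDim_rightIdeal_baseChange [IsDomain R'] [IsPrincipalIdealRing R'] [Module.Finite R H]
    (L : FinRightMod.{max u v} R' (R' ⊗[R] H)) [Module.Free R' L] {g : R' ⊗[R] H}
    (hg : IsIdempotentElem g) :
    homDim (FinRightMod.rightIdeal K (scalarExtensionMap R R' K H g))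
        (FinRightMod.baseChange (S' := K) L) =
      Module.finrank R' (LinearMap.range (Algebra.lsmul R' R' L (MulOpposite.op g))) := by
  rw [homDim_rightIdeal (hg.map (scalarExtensionMap R R' K H)), show
    Algebra.lsmul K K (FinRightMod.baseChange (S' := K) L)
      (MulOpposite.op (scalarExtensionMap R R' K H g)) = _ from
    baseChangeAction_scalarExtensionMap L g]
  refine congrArg Nat.cast (finrank_range_baseChange ?_)
  rw [← Module.End.mul_eq_comp, ← map_mul, ← MulOpposite.op_mul, hg.eq]

/-- Every `KH`-module contains an `R'H`-lattice: the one generated by a `K`-basis. -/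
theorem FinRightMod.exists_lattice [IsDomain R'] [IsPrincipalIdealRing R'] [IsFractionRing R' K]
    [Module.Finite R H] (V : FinRightMod.{max u v} K (K ⊗[R] H)) :
    ∃ L : FinRightMod.{max u v} R' (R' ⊗[R] H), Module.Free R' L ∧
      Nonempty (FinRightMod.baseChange (S' := K) L ≃ₗ[(K ⊗[R] H)ᵐᵒᵖ] V) := by
  let jop := AlgHom.op (scalarExtensionAlgHom R R' K H)
  let _ : Module R' V := Module.compHom V (algebraMap R' K)
  have : IsScalarTower R' K V := IsScalarTower.of_algebraMap_smul fun _ _ => rfl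
  let _ : Module (R' ⊗[R] H)ᵐᵒᵖ V := Module.compHom V jop.toRingHom
  have hact : ∀ (x : (R' ⊗[R] H)ᵐᵒᵖ) (v : V), x • v = jop x • v := fun _ _ => rfl
  have : IsScalarTower R' (R' ⊗[R] H)ᵐᵒᵖ V := IsScalarTower.of_algebraMap_smul fun c v => by
    rw [hact, AlgHom.commutes, IsScalarTower.algebraMap_apply R' K (K ⊗[R] H)ᵐᵒᵖ, algebraMap_smul,
      algebraMap_smul]
  let b := Module.finBasis K V
  let N : Submodule (R' ⊗[R] H)ᵐᵒᵖ V := Submodule.span _ (Set.range b)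
  have : Module.Finite R' (R' ⊗[R] H)ᵐᵒᵖ :=
    Module.Finite.equiv (MulOpposite.opLinearEquiv R' : R' ⊗[R] H ≃ₗ[R'] _)
  have : Module.Finite (R' ⊗[R] H)ᵐᵒᵖ N := Module.Finite.span_of_finite _ (Set.finite_range b)
  have hfin : Module.Finite R' N := Module.Finite.trans (R' ⊗[R] H)ᵐᵒᵖ N
  let N' : Submodule R' V := N.restrictScalars R'
  have : N'.IsLattice K := by
    refine ⟨Module.Finite.iff_fg.1 (inferInstanceAs (Module.Finite R' N)), eq_top_iff.2 ?_⟩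
    rw [← b.span_eq]
    exact Submodule.span_mono Submodule.subset_span
  have hfree : Module.Free R' N' := Submodule.IsLattice.free K N'
  let L : FinRightMod.{max u v} R' (R' ⊗[R] H) := { carrier := N }
  refine ⟨L, hfree, ?_⟩
  let c := Module.Free.chooseBasis R' N'
  let e' : K ⊗[R'] N' →ₗ[K] V := N'.subtype.liftBaseChange K
  have he' : e' = ((c.baseChange K).equiv (c.extendOfIsLattice K) (Equiv.refl _)).toLinearMap :=
    (c.baseChange K).ext fun i => by
      rw [LinearEquiv.coe_coe, Module.Basis.equiv_apply]
      simp [e']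
  have hbij' : Function.Bijective e' := by
    rw [he']
    exact LinearEquiv.bijective _
  let e : K ⊗[R'] L →ₗ[K] V := e'
  have hbij : Function.Bijective e := hbij'
  have he : ∀ (r : K) (n : L), e (r ⊗ₜ[R'] n) = r • N.subtype n := fun r n =>
    LinearMap.liftBaseChange_tmul ..
  have hlin : ∀ (x : (K ⊗[R] H)ᵐᵒᵖ) (y : K ⊗[R'] L), e (baseChangeAction K L x y) = x • e y := by
    intro x y
    induction x using MulOpposite.rec' with
    | _ x =>
    induction x with
    | zero => rw [MulOpposite.op_zero, zero_smul, map_zero]; exact map_zero e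
    | add x x' hx hx' =>
      rw [MulOpposite.op_add, add_smul, ← hx, ← hx', map_add]; exact map_add e _ _
    | tmul s h =>
      induction y using TensorProduct.induction_on with
      | zero => rw [map_zero, map_zero, smul_zero]
      | add y y' hy hy' => rw [map_add, map_add, map_add, smul_add, hy, hy']
      | tmul t l =>
        have h1 : (s ⊗ₜ[R] h : K ⊗[R] H) = s • ((1 : K) ⊗ₜ[R] h) := by
          rw [TensorProduct.smul_tmul', smul_eq_mul, mul_one]
        have h2 : jop (MulOpposite.op ((1 : R') ⊗ₜ[R] h)) = MulOpposite.op ((1 : K) ⊗ₜ[R] h) := by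
          refine congrArg MulOpposite.op ?_
          change (algebraMap R' K 1) ⊗ₜ[R] h = _
          rw [map_one]
        rw [baseChangeAction_tmul, he, he, h1, MulOpposite.op_smul, smul_assoc, mul_smul,
          smul_comm (MulOpposite.op ((1 : K) ⊗ₜ[R] h)) t, ← h2]
        rfl
  let E : FinRightMod.baseChange (S' := K) L →ₗ[(K ⊗[R] H)ᵐᵒᵖ] V :=
    { toFun := e, map_add' := e.map_add, map_smul' := hlin }
  exact ⟨LinearEquiv.ofBijective E hbij⟩

end Lattice

/-! ### Decomposition map and Brauer reciprocity -/

section Reciprocity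

variable {F A : Type*} [Field F] [Ring A] [Algebra F A]

theorem IsSimplePIMSystem.R0_ext {ι : Type*} {S P : ι → FinRightMod.{w} F A}
    (h : IsSimplePIMSystem S P) (hA : IsSplittingFieldFor.{w} F A) {y y' : R0.{w} F A}
    (hy : ∀ i, grothendieckPairing F A (K0.mk (P i) (h.projective i)) y =
      grothendieckPairing F A (K0.mk (P i) (h.projective i)) y') : y = y' :=
  (h.basisR0 hA).ext_elem fun i => by rw [h.basisR0_repr, h.basisR0_repr, hy]

theorem IsSimplePIMSystem.K0_ext {ι : Type*} {S P : ι → FinRightMod.{w} F A}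
    (h : IsSimplePIMSystem S P) (hA : IsSplittingFieldFor.{w} F A) {x x' : K0.{w} F A}
    (hx : ∀ i, grothendieckPairing F A x (R0.mk (S i)) =
      grothendieckPairing F A x' (R0.mk (S i))) : x = x' :=
  (h.basisK0 hA).ext_elem fun i => by rw [h.basisK0_repr, h.basisK0_repr, hx]

variable {R R' K k : Type u} {H : Type v}
  [CommRing R] [CommRing R'] [Field K] [Field k] [Ring H]
  [Algebra R R'] [Algebra R K] [Algebra R k] [Algebra R' K] [Algebra R' k]
  [IsScalarTower R R' K] [IsScalarTower R R' k] [Algebra R H] [Module.Finite R H]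

/-- Brauer reciprocity for an idempotent `g` of `R'H` and an `R'H`-lattice `L`: both sides are the
rank of `L g`. -/
theorem grothendieckPairing_ofIdempotent_baseChange [IsDomain R'] [IsPrincipalIdealRing R']
    {g : R' ⊗[R] H} (hg : IsIdempotentElem g) (L : FinRightMod.{max u v} R' (R' ⊗[R] H))
    [Module.Free R' L] {f : k ⊗[R] H} (hf : IsIdempotentElem f)
    (hgf : scalarExtensionMap R R' k H g = f) :
    grothendieckPairing K (K ⊗[R] H)
        (K0.ofIdempotent K (scalarExtensionMap R R' K H g) (hg.map (scalarExtensionMap R R' K H)))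
        (R0.mk (FinRightMod.baseChange (S' := K) L)) =
      grothendieckPairing k (k ⊗[R] H) (K0.ofIdempotent k f hf)
        (R0.mk (FinRightMod.baseChange (S' := k) L)) := by
  subst hgf
  rw [K0.ofIdempotent, K0.ofIdempotent, grothendieckPairing_mk, grothendieckPairing_mk]
  exact (homDim_rightIdeal_baseChange L hg).trans (homDim_rightIdeal_baseChange L hg).symm

/-- The decomposition map and the idempotent lifting map are uniquely determined, and dual to each
other. -/
theorem exists_decompositionMap_idempotentLiftMap [Module.Flat R H] [IsDomain R']
    [IsDiscreteValuationRing R'] [IsFractionRing R' K] (hk : Function.Surjective (algebraMap R' k))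
    (hK : IsSplittingFieldFor.{max u v} K (K ⊗[R] H))
    (hk' : IsSplittingFieldFor.{max u v} k (k ⊗[R] H)) :
    ∃ (d : R0.{max u v} K (K ⊗[R] H) →+ R0.{max u v} k (k ⊗[R] H))
      (e : K0.{max u v} k (k ⊗[R] H) →+ K0.{max u v} K (K ⊗[R] H)),
      (IsDecompositionMap R R' K k H d ∧ ∀ d', IsDecompositionMap R R' K k H d' → d' = d) ∧
      (IsIdempotentLiftMap R R' K k H e ∧ ∀ e', IsIdempotentLiftMap R R' K k H e' → e' = e) ∧
      ∀ x y, grothendieckPairing K (K ⊗[R] H) (e x) y =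
        grothendieckPairing k (k ⊗[R] H) x (d y) := by
  obtain ⟨ι, S, p, -, hS⟩ := exists_isSimplePIMSystem K (K ⊗[R] H)
  obtain ⟨κ, T, f, hf, hT⟩ := exists_isSimplePIMSystem k (k ⊗[R] H)
  choose L hL φ using fun i => (S i).exists_lattice (R' := R')
  choose g hg hgf using fun j => exists_isIdempotentElem_scalarExtensionMap_eq (R' := R') hk hK
    (hf j).2.1
  let gK : κ → K0.{max u v} K (K ⊗[R] H) := fun j =>
    K0.ofIdempotent K (scalarExtensionMap R R' K H (g j)) ((hg j).map (scalarExtensionMap R R' K H))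
  let d : R0.{max u v} K (K ⊗[R] H) →+ R0.{max u v} k (k ⊗[R] H) :=
    ((hS.basisR0 hK).constr ℤ fun i =>
      R0.mk (FinRightMod.baseChange (S' := k) (L i))).toAddMonoidHom
  let e : K0.{max u v} k (k ⊗[R] H) →+ K0.{max u v} K (K ⊗[R] H) :=
    ((hT.basisK0 hk').constr ℤ gK).toAddMonoidHom
  have hd : ∀ i, d (R0.mk (S i)) = R0.mk (FinRightMod.baseChange (S' := k) (L i)) := fun i => by
    rw [← hS.basisR0_apply hK]
    exact (hS.basisR0 hK).constr_basis ℤ _ i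
  have he : ∀ j, e (K0.ofIdempotent k (f j) (hf j).2.1) = gK j := fun j =>
    (congrArg e (hT.basisK0_apply hk' j).symm).trans ((hT.basisK0 hk').constr_basis ℤ _ j)
  have hdual : ∀ x y, grothendieckPairing K (K ⊗[R] H) (e x) y =
      grothendieckPairing k (k ⊗[R] H) x (d y) := by
    have h1 : ∀ i j, grothendieckPairing K (K ⊗[R] H) (gK j) (R0.mk (S i)) =
        grothendieckPairing k (k ⊗[R] H) (K0.ofIdempotent k (f j) (hf j).2.1)
          (d (R0.mk (S i))) := fun i j => by
      have := hL i
      rw [hd, ← R0.mk_congr (φ i).some]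
      exact grothendieckPairing_ofIdempotent_baseChange (hg j) (L i) (hf j).2.1 (hgf j)
    have h2 : ∀ j, (grothendieckPairing K (K ⊗[R] H) (gK j)).toIntLinearMap =
        ((grothendieckPairing k (k ⊗[R] H) (K0.ofIdempotent k (f j) (hf j).2.1)).comp
          d).toIntLinearMap := fun j => (hS.basisR0 hK).ext fun i => by
      rw [hS.basisR0_apply]
      exact h1 i j
    intro x y
    have h3 : (((grothendieckPairing K (K ⊗[R] H)).flip y).comp e).toIntLinearMap =
        ((grothendieckPairing k (k ⊗[R] H)).flip (d y)).toIntLinearMap :=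
      (hT.basisK0 hk').ext fun j => by
        rw [hT.basisK0_apply]
        change grothendieckPairing K (K ⊗[R] H) (e (K0.ofIdempotent k (f j) (hf j).2.1)) y = _
        rw [he]
        exact LinearMap.congr_fun (h2 j) y
    exact LinearMap.congr_fun h3 x
  refine ⟨d, e, ⟨?_, fun d' hd' => ?_⟩, ⟨?_, fun e' he' => ?_⟩, hdual⟩
  · intro V _ L' _ hV
    obtain ⟨ψ⟩ := hV
    refine hT.R0_ext hk' fun j => ?_
    rw [← hdual]
    refine (congrArg (fun x => grothendieckPairing K (K ⊗[R] H) x (R0.mk V)) (he j)).trans ?_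
    rw [← R0.mk_congr ψ]
    exact grothendieckPairing_ofIdempotent_baseChange (hg j) L' (hf j).2.1 (hgf j)
  · have : AddMonoidHom.eqLocus d' d = ⊤ := R0.eq_top_of_simple_mem fun V hV => by
      obtain ⟨i, ⟨ψ⟩⟩ := hS.complete V hV
      change d' (R0.mk V) = d (R0.mk V)
      rw [R0.mk_congr ψ, hd]
      exact hd' (S i) (hS.simple i) (L i) (hL i) (φ i)
    exact AddMonoidHom.eq_of_eqOn_topM fun x _ => by
      have hx : x ∈ (⊤ : AddSubgroup (R0.{max u v} K (K ⊗[R] H))) := trivial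
      rwa [← this] at hx
  · intro f' hf' g' hg' hgf'
    refine hS.K0_ext hK fun i => ?_
    have := hL i
    rw [hdual, hd, ← R0.mk_congr (φ i).some]
    exact (grothendieckPairing_ofIdempotent_baseChange hg' (L i) hf'.2.1 hgf').symm
  · have : e'.toIntLinearMap = e.toIntLinearMap := (hT.basisK0 hk').ext fun j => by
      rw [hT.basisK0_apply]
      change e' (K0.ofIdempotent k (f j) (hf j).2.1) = e (K0.ofIdempotent k (f j) (hf j).2.1)
      rw [he]
      exact he' (f j) (hf j) (g j) (hg j) (hgf j)
    exact DFunLike.ext _ _ (LinearMap.congr_fun this)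

end Reciprocity

theorem proposition5p2
    {K : Type u} [Field K] [NumberField K]
    (p : Ideal (𝓞 K)) [p.IsPrime] (hp : p ≠ ⊥)
    -- the unique structure of `K` as an algebra over the localisation, extending that over `𝓞 K`
    [Algebra (Localization.AtPrime p) K] [IsScalarTower (𝓞 K) (Localization.AtPrime p) K]
    (H : Type v) [Ring H] [Algebra (𝓞 K) H] [Module.Free (𝓞 K) H] [Module.Finite (𝓞 K) H]
    (hK : IsSplittingFieldFor.{max u v} K (K ⊗[𝓞 K] H))
    (hk : IsSplittingFieldFor.{max u v} p.ResidueField (p.ResidueField ⊗[𝓞 K] H)) :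
    -- the decomposition map and the map given by lifting idempotents are well defined
    ∃ (d : R0.{max u v} K (K ⊗[𝓞 K] H) →+
          R0.{max u v} p.ResidueField (p.ResidueField ⊗[𝓞 K] H))
      (e : K0.{max u v} p.ResidueField (p.ResidueField ⊗[𝓞 K] H) →+
          K0.{max u v} K (K ⊗[𝓞 K] H)),
      (IsDecompositionMap (𝓞 K) (Localization.AtPrime p) K p.ResidueField H d ∧
        ∀ d', IsDecompositionMap (𝓞 K) (Localization.AtPrime p) K p.ResidueField H d' → d' = d) ∧
      (IsIdempotentLiftMap (𝓞 K) (Localization.AtPrime p) K p.ResidueField H e ∧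
        ∀ e', IsIdempotentLiftMap (𝓞 K) (Localization.AtPrime p) K p.ResidueField H e' →
          e' = e) ∧
      -- `e` is dual to `d`
      (∀ (x : K0.{max u v} p.ResidueField (p.ResidueField ⊗[𝓞 K] H))
          (y : R0.{max u v} K (K ⊗[𝓞 K] H)),
        grothendieckPairing K (K ⊗[𝓞 K] H) (e x) y =
          grothendieckPairing p.ResidueField (p.ResidueField ⊗[𝓞 K] H) x (d y)) ∧
      -- the matrix of `e` is the transpose of the decomposition matrix
      (∀ (ι : Type*) (S P : ι → FinRightMod.{max u v} K (K ⊗[𝓞 K] H))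
          (κ : Type*)
          (T Q : κ → FinRightMod.{max u v} p.ResidueField (p.ResidueField ⊗[𝓞 K] H))
          (hSP : IsSimplePIMSystem S P) (hTQ : IsSimplePIMSystem T Q),
        ∃ (bS : Module.Basis ι ℤ (R0.{max u v} K (K ⊗[𝓞 K] H)))
          (bP : Module.Basis ι ℤ (K0.{max u v} K (K ⊗[𝓞 K] H)))
          (bT : Module.Basis κ ℤ (R0.{max u v} p.ResidueField (p.ResidueField ⊗[𝓞 K] H)))
          (bQ : Module.Basis κ ℤ (K0.{max u v} p.ResidueField (p.ResidueField ⊗[𝓞 K] H))),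
          (∀ i, bS i = R0.mk (S i)) ∧ (∀ i, bP i = K0.mk (P i) (hSP.projective i)) ∧
          (∀ j, bT j = R0.mk (T j)) ∧ (∀ j, bQ j = K0.mk (Q j) (hTQ.projective j)) ∧
          rowMatrix bQ bP e = (rowMatrix bS bT d)ᵀ) := by
  have : IsDomain (Localization.AtPrime p) :=
    IsLocalization.isDomain_localization p.primeCompl_le_nonZeroDivisors
  have : IsDiscreteValuationRing (Localization.AtPrime p) :=
    IsLocalization.AtPrime.isDiscreteValuationRing_of_dedekind_domain _ hp _
  have : IsFractionRing (Localization.AtPrime p) K :=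
    IsFractionRing.isFractionRing_of_isDomain_of_isLocalization p.primeCompl _ _
  obtain ⟨d, e, hd, he, hde⟩ := exists_decompositionMap_idempotentLiftMap
    (R' := Localization.AtPrime p) (k := p.ResidueField) (H := H)
    IsLocalRing.residue_surjective hK hk
  refine ⟨d, e, hd, he, hde, fun ι S P κ T Q hSP hTQ => ⟨hSP.basisR0 hK, hSP.basisK0 hK,
    hTQ.basisR0 hk, hTQ.basisK0 hk, hSP.basisR0_apply hK, hSP.basisK0_apply hK,
    hTQ.basisR0_apply hk, hTQ.basisK0_apply hk, ?_⟩⟩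
  ext j i
  simp only [rowMatrix, Matrix.of_apply, Matrix.transpose_apply]
  rw [hSP.basisK0_repr, hTQ.basisR0_repr, hTQ.basisK0_apply, hSP.basisR0_apply, hde]
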